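/- **Theorem.** Let $(M,F)$ be a forward complete Finsler manifold: $M$ is a connected smooth $n$-dimensional manifold (Hausdorff, second countable, without boundary); $F:TM\to[0,\infty)$ is continuous, smooth off the zero section, satisfies $F(x,\lambda y)=\lambda F(x,y)$ for $\lambda\ge 0$ (it need not be reversible), and $g_y=\tfrac12\big(\partial^2F^2/\partial y^i\partial y^j\big)$ is positive definite for every $y\ne 0$; and every geodesic defined on $[0,1)$ extends to a geodesic defined on $[0,\infty)$. Let $\mathfrak m$ be a smooth measure on $M$, i.e. $d\mathfrak m=\sigma\,dx^1\cdots dx^n$ in each chart with $\sigma>0$ smooth. Let $F^*(x,\xi)=\sup_{y\in T_xM\setminus\{0\}}\xi(y)/F(x,y)$ be the dual metric, let $\mathfrak L(X)=g_X(X,\cdot)$, $\mathfrak L(0)=0$, be the Legendre transformation, and write $\nabla\rho=\mathfrak L^{-1}(d\rho)$ for the gradient of a function with (weak) differential $d\rho$. Let $\Omega\subset M$ be a natural domain, i.e. a connected non-empty open set such that either $\Omega\neq M$ and the boundary $\partial\Omega$ is non-empty and smooth (locally, $\partial\Omega$ is an embedded smooth submanifold of some dimension, so that $M\setminus\{o\}$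 is allowed), or $\Omega=M$ and $M$ is noncompact. Let $W^{1,p}_{\rm loc}(\Omega)$ be the space of functions $\rho$ which, on every open $U$ with compact closure in $\Omega$, lie in $W^{1,p}(U)$, the completion of the space of all $f\in C^\infty(U)$ of finite norm $\big(\int_U|f|^p\,d\mathfrak m+\int_UF^{*p}(df)\,d\mathfrak m\big)^{1/p}$. Let $p>1$ and $\alpha\in\mathbb R$, and let $\rho\in W^{1,p}_{\rm loc}(\Omega)$ be nonnegative almost everywhere in $\Omega$ and satisfy: 1. $-(p-1-\alpha)\Delta_p\rho\ge 0$ in the weak sense, that is, $$(p-1-\alpha)\int_\Omega F^{p-2}(\nabla\rho)\,dv(\nabla\rho)\,d\mathfrak m\ \ge\ 0\qquad\text{for all } v\in C^1_0(\Omega),\ v\ge 0,$$ where the integrand is $0$ wherever $\nabla\rho=0$; 2. if $\alpha>p$, then also $\dfrac{F^p(\nabla\rho)}{\rho^{p-\alpha}}\in L^1_{\rm loc}(\Omega)$ and $\rho^\alpha\in L^1_{\rm loc}(\Omega)$. Then, for every $u\in C^\infty_0(\Omega)$, $$\int_\Omega\rho^\alpha\,\max\{F^{*p}(du),F^{*p}(-du)\}\,d\mathfrak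 m\ \ge\ \Big(\frac{|p-1-\alpha|}{p}\Big)^p\int_\Omega\frac{F^p(\nabla\rho)}{\rho^{p-\alpha}}\,|u|^p\,d\mathfrak m .$$ Both sides are integrals of nonnegative functions with values in $[0,\infty]$. At points with $\rho=0$ the conventions are $0^s=+\infty$ for $s<0$, $0^0=1$, $0\cdot\infty=0$, and the integrand on the right is $0$ where $\nabla\rho=0$ or $u=0$. -/

import Mathlib

open Set Filter Topology MeasureTheory
open scoped Manifold ContDiff ENNReal

noncomputable section

namespace FinslerHardy

variable {n : ℕ} {M : Type*} [TopologicalSpace M] [ChartedSpace (EuclideanSpace ℝ (Fin n)) M]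

/-- The cotangent space `T*_x M`. -/
abbrev Cotangent (n : ℕ) {M : Type*} [TopologicalSpace M]
    [ChartedSpace (EuclideanSpace ℝ (Fin n)) M] (x : M) : Type :=
  TangentSpace (𝓡 n) x →L[ℝ] ℝ

/-- The differential `du|_x` of a real function, as a covector. -/
def differential (u : M → ℝ) (x : M) : Cotangent n x :=
  mfderiv (𝓡 n) 𝓘(ℝ, ℝ) u x

/-- The Hessian `D²(f² / 2)(y)` of half the square of a function `f` on `ℝⁿ`. -/
def halfSqHessian (f : EuclideanSpace ℝ (Fin n) → ℝ) (y : EuclideanSpace ℝ (Fin n)) :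
    EuclideanSpace ℝ (Fin n) →L[ℝ] EuclideanSpace ℝ (Fin n) →L[ℝ] ℝ :=
  fderiv ℝ (fderiv ℝ fun z => (1 / 2 : ℝ) * f z ^ 2) y

/-- The fundamental tensor `g_y = D²(F(x, ·)² / 2)(y)`, a bilinear form on `T_x M`. -/
def fundamentalTensor (F : TangentBundle (𝓡 n) M → ℝ) (x : M) (y : TangentSpace (𝓡 n) x) :
    TangentSpace (𝓡 n) x →L[ℝ] Cotangent n x :=
  halfSqHessian (fun z : EuclideanSpace ℝ (Fin n) => F (⟨x, z⟩ : TangentBundle (𝓡 n) M)) y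

/-- Finsler metrics, not necessarily reversible. -/
structure IsFinslerMetric [IsManifold (𝓡 n) ∞ M] (F : TangentBundle (𝓡 n) M → ℝ) : Prop where
  nonneg : ∀ v, 0 ≤ F v
  continuous : Continuous F
  smooth : ContMDiffOn (𝓡 n).tangent 𝓘(ℝ, ℝ) ∞ F {v | v.2 ≠ 0}
  homogeneous : ∀ (x : M) (y : TangentSpace (𝓡 n) x) (c : ℝ), 0 ≤ c →
    F ⟨x, c • y⟩ = c * F ⟨x, y⟩
  posDef : ∀ (x : M) (y : TangentSpace (𝓡 n) x), y ≠ 0 →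
    ∀ v : TangentSpace (𝓡 n) x, v ≠ 0 → 0 < fundamentalTensor F x y v v

/-- The dual metric `F*(x, ξ) = sup_{y ≠ 0} ξ(y) / F(x, y)`. -/
def dualMetric (F : TangentBundle (𝓡 n) M → ℝ) (x : M) (ξ : Cotangent n x) : ℝ :=
  ⨆ y : {y : TangentSpace (𝓡 n) x // y ≠ 0}, ξ y.1 / F ⟨x, y.1⟩

/-- The Legendre transformation `X ↦ g_X(X, ·)`, with `0 ↦ 0`. -/
def legendre (F : TangentBundle (𝓡 n) M → ℝ) (x : M) (X : TangentSpace (𝓡 n) x) :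
    Cotangent n x :=
  open Classical in if X = 0 then 0 else fundamentalTensor F x X X

/-- The inverse of the Legendre transformation on `T*_x M`. The gradient of a function with
differential `η` is `legendreInv F x (η x)`. -/
def legendreInv (F : TangentBundle (𝓡 n) M → ℝ) (x : M) (ξ : Cotangent n x) :
    TangentSpace (𝓡 n) x :=
  Function.invFun (legendre F x) ξ

/-! ### Geodesics and forward completeness -/

/-- `F` in the local coordinates of the chart `e`: the value of `F` at the tangent vector with
components `y` at the point with coordinates `z`. -/
def chartMetric (F : TangentBundle (𝓡 n) M → ℝ)
    (e : OpenPartialHomeomorph M (EuclideanSpace ℝ (Fin n)))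
    (z y : EuclideanSpace ℝ (Fin n)) : ℝ :=
  F ⟨e.symm z, mfderiv (𝓡 n) (𝓡 n) e.symm z y⟩

/-- The components `g_{ij}(z, y)` of the fundamental tensor in the chart `e`. -/
def chartTensor (F : TangentBundle (𝓡 n) M → ℝ)
    (e : OpenPartialHomeomorph M (EuclideanSpace ℝ (Fin n)))
    (z y : EuclideanSpace ℝ (Fin n)) : Matrix (Fin n) (Fin n) ℝ :=
  Matrix.of fun i j =>
    halfSqHessian (chartMetric F e z) y (EuclideanSpace.single i 1) (EuclideanSpace.single j 1)

/-- The partial derivative `∂g_{ij}/∂x^k (z, y)` in the chart `e`. -/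
def chartTensorDeriv (F : TangentBundle (𝓡 n) M → ℝ)
    (e : OpenPartialHomeomorph M (EuclideanSpace ℝ (Fin n)))
    (k i j : Fin n) (z y : EuclideanSpace ℝ (Fin n)) : ℝ :=
  fderiv ℝ (fun z' => chartTensor F e z' y i j) z (EuclideanSpace.single k 1)

/-- The geodesic coefficients
`G^i = (1/4) g^{il} (2 ∂g_{jl}/∂x^k - ∂g_{jk}/∂x^l) y^j y^k` in the chart `e`
(so that `G^i = 0` at `y = 0`). -/
def geodesicCoeff (F : TangentBundle (𝓡 n) M → ℝ)
    (e : OpenPartialHomeomorph M (EuclideanSpace ℝ (Fin n)))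
    (z y : EuclideanSpace ℝ (Fin n)) : EuclideanSpace ℝ (Fin n) :=
  WithLp.toLp 2 fun i => (1 / 4 : ℝ) * ∑ l, ∑ j, ∑ k, (chartTensor F e z y)⁻¹ i l *
    (2 * chartTensorDeriv F e k j l z y - chartTensorDeriv F e l j k z y) * y j * y k

/-- `γ` is a (constant speed) geodesic on the interval `J`: it is smooth on `J` and satisfies
`γ'' + 2 G(γ') = 0` in all charts at the interior times (hence, by continuity, up to the end
points that belong to `J`). -/
def IsGeodesicOn (F : TangentBundle (𝓡 n) M → ℝ) (γ : ℝ → M) (J : Set ℝ) : Prop :=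
  ContMDiffOn 𝓘(ℝ, ℝ) (𝓡 n) ∞ γ J ∧
  ∀ e ∈ atlas (EuclideanSpace ℝ (Fin n)) M, ∀ t ∈ interior J, γ t ∈ e.source →
    deriv (deriv (fun s => e (γ s))) t +
      (2 : ℝ) • geodesicCoeff F e (e (γ t)) (deriv (fun s => e (γ s)) t) = 0

/-- Forward completeness: geodesics on `[0, 1)` extend to geodesics on `[0, ∞)`. -/
def IsForwardComplete (F : TangentBundle (𝓡 n) M → ℝ) : Prop :=
  ∀ γ : ℝ → M, IsGeodesicOn F γ (Ico 0 1) →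
    ∃ γ' : ℝ → M, IsGeodesicOn F γ' (Ici 0) ∧ EqOn γ' γ (Ico 0 1)

/-! ### Smooth measures and natural domains -/

/-- Smooth measures: in every chart, `𝔪 = σ dx¹ ⋯ dxⁿ` with a smooth positive density `σ`. -/
def IsSmoothMeasure (n : ℕ) {M : Type*} [TopologicalSpace M]
    [ChartedSpace (EuclideanSpace ℝ (Fin n)) M] [MeasurableSpace M] (𝔪 : Measure M) : Prop :=
  ∀ e ∈ atlas (EuclideanSpace ℝ (Fin n)) M, ∃ σ : EuclideanSpace ℝ (Fin n) → ℝ,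
    ContDiffOn ℝ ∞ σ e.target ∧ (∀ z ∈ e.target, 0 < σ z) ∧
    (𝔪.restrict e.source).map e =
      (volume.restrict e.target).withDensity fun z => ENNReal.ofReal (σ z)

/-- The topological boundary of `Ω` is smooth: it is an embedded smooth submanifold, i.e. near
each of its points it is a linear slice in some chart of the smooth structure. The dimension of
the submanifold is not prescribed, so that the complement of a point is allowed. -/
def HasSmoothBoundary (n : ℕ) {M : Type*} [TopologicalSpace M]
    [ChartedSpace (EuclideanSpace ℝ (Fin n)) M] (Ω : Set M) : Prop :=
  ∀ x ∈ frontier Ω, ∃ e ∈ IsManifold.maximalAtlas (𝓡 n) ∞ M, x ∈ e.source ∧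
    ∃ V : Submodule ℝ (EuclideanSpace ℝ (Fin n)),
      ∀ x' ∈ e.source, x' ∈ frontier Ω ↔ e x' ∈ V

/-- Natural domains: proper domains with smooth non-empty boundary, or all of `M` if `M` is not
compact. -/
def IsNaturalDomain (n : ℕ) {M : Type*} [TopologicalSpace M]
    [ChartedSpace (EuclideanSpace ℝ (Fin n)) M] (Ω : Set M) : Prop :=
  IsOpen Ω ∧ IsConnected Ω ∧
    ((Ω ≠ univ ∧ (frontier Ω).Nonempty ∧ HasSmoothBoundary n Ω) ∨
      (Ω = univ ∧ NoncompactSpace M))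

/-! ### Sobolev functions and the weak inequality -/

/-- The functions of class `C^k` on `M` with compact support contained in `Ω`. -/
def IsTestFunction (n : ℕ) {M : Type*} [TopologicalSpace M]
    [ChartedSpace (EuclideanSpace ℝ (Fin n)) M] (k : WithTop ℕ∞) (Ω : Set M) (u : M → ℝ) :
    Prop :=
  ContMDiff (𝓡 n) 𝓘(ℝ, ℝ) k u ∧ HasCompactSupport u ∧ tsupport u ⊆ Ω

/-- A covector field is measurable on `Ω` if its components in every chart are (almost everywhere)
measurable. -/
def IsMeasurableCovectorField [MeasurableSpace M] (𝔪 : Measure M) (Ω : Set M)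
    (η : (x : M) → Cotangent n x) : Prop :=
  ∀ e ∈ atlas (EuclideanSpace ℝ (Fin n)) M, ∀ v : EuclideanSpace ℝ (Fin n),
    AEMeasurable (fun x => η x (mfderiv (𝓡 n) (𝓡 n) e.symm (e x) v : TangentSpace (𝓡 n) x))
      (𝔪.restrict (e.source ∩ Ω))

/-- The `p`-th power of the norm of `W^{1,p}(U)`, namely `∫_U |f|^p d𝔪 + ∫_U F*(η)^p d𝔪`, of a
function `f` with (weak) differential `η`. -/
def sobolevEnergy [MeasurableSpace M] (F : TangentBundle (𝓡 n) M → ℝ) (𝔪 : Measure M) (p : ℝ)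
    (U : Set M) (f : M → ℝ) (η : (x : M) → Cotangent n x) : ℝ≥0∞ :=
  (∫⁻ x in U, ENNReal.ofReal (|f x| ^ p) ∂𝔪) +
    ∫⁻ x in U, ENNReal.ofReal (dualMetric F x (η x) ^ p) ∂𝔪

/-- `ρ ∈ W^{1,p}_loc(Ω)` with weak differential `η`: on every open `U` which is relatively compact
in `Ω`, the pair `(ρ, η)` is the limit, in the norm of `W^{1,p}(U)`, of smooth functions on `U` of
finite norm and their differentials, i.e. `ρ` belongs to the completion `W^{1,p}(U)` of this space
of smooth functions. -/
structure HasWeakDifferential [MeasurableSpace M] (F : TangentBundle (𝓡 n) M → ℝ)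
    (𝔪 : Measure M) (p : ℝ) (Ω : Set M) (ρ : M → ℝ) (η : (x : M) → Cotangent n x) : Prop where
  aemeasurable : AEMeasurable ρ (𝔪.restrict Ω)
  measurable_differential : IsMeasurableCovectorField 𝔪 Ω η
  approx : ∀ U : Set M, IsOpen U → IsCompact (closure U) → closure U ⊆ Ω →
    ∃ φ : ℕ → M → ℝ,
      (∀ j, ContMDiffOn (𝓡 n) 𝓘(ℝ, ℝ) ∞ (φ j) U ∧
        sobolevEnergy F 𝔪 p U (φ j) (differential (φ j)) ≠ ⊤) ∧
      Tendsto (fun j => sobolevEnergy F 𝔪 p U (fun x => φ j x - ρ x)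
        (fun x => differential (φ j) x - η x)) atTop (𝓝 0)

/-- `-c Δ_p ρ ≥ 0` weakly in `Ω`, for a function `ρ` with weak differential `η`, i.e. with
gradient `∇ρ = legendreInv F x (η x)`:
`c ∫_Ω F^{p-2}(∇ρ) ⟨∇ρ, dv⟩ d𝔪 ≥ 0` for all nonnegative `v ∈ C¹_0(Ω)`. -/
def WeakNegPLaplacianNonneg [MeasurableSpace M] (F : TangentBundle (𝓡 n) M → ℝ)
    (𝔪 : Measure M) (p c : ℝ) (Ω : Set M) (η : (x : M) → Cotangent n x) : Prop :=
  ∀ v : M → ℝ, IsTestFunction n 1 Ω v → (∀ x, 0 ≤ v x) →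
    0 ≤ c * ∫ x in Ω, F ⟨x, legendreInv F x (η x)⟩ ^ (p - 2) *
      differential v x (legendreInv F x (η x)) ∂𝔪

end FinslerHardy

end

noncomputable section

namespace FinslerHardy

section

/-! ### Minkowski norms on `ℝⁿ` -/

/-! The idea is to test the weak inequality with `v = |u|^p * ρ^b`, where `b = α + 1 - p`. Write `c
= p - 1 - α = -b` and `N = F(∇ρ)`. Since `dρ(∇ρ) = N²`, expanding `dv` gives `c * ∫ (ρ^b *
p|u|^(p-2) u N^(p-2) du(∇ρ) + b ρ^(b-1) |u|^p N^p) ≥ 0`. As `c * b < 0`, the second term can be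
bounded by the first. With `|du(∇ρ)| ≤ max (F*(du)) (F*(-du)) * N` and Hölder's inequality, a factor
`I^(1/q)` of `I = ∫ |u|^p |ψ'(ρ)| N^p`, where `ψ(s) = s^b`, can be cancelled. This leaves `I ≤ p^p ∫
ψ(ρ)^p |ψ'(ρ)|^(1-p) max(F*(du), F*(-du))^p`. For `ψ(s) = s^b` one has `ψ^p |ψ'|^(1-p) = |b|^(1-p)
s^α` and `|ψ'| = |b| s^(α-p)`, which is the claim with its constant.

This `v` is not admissible: `ρ` is only a Sobolev function, may vanish, and the power may grow too
fast. So `s^b` is first replaced by a positive `C¹` function `ψ` on the line with bounded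
derivative, built from `posShift` and `modPow`. `WeakNegPLaplacianNonneg.exists_limit` obtains the
inequality for `|u|^p ψ(ρ)` from the test functions `|u|^p ψ(φ_j)`, with `φ_j` smooth and converging
to `ρ`. `lintegral_le_of_weak` does the absorption for a general `ψ`. `lintegral_le_of_truncated`
removes the regularization, by Fatou's lemma on the left and by comparison or domination on the
right.

The Finsler input is fibrewise. The Legendre transformation is bijective
(`IsMinkowskiNorm.leg_injective`, `IsMinkowskiNorm.leg_surjective`), its inverse is the unique
minimizer of `F²/2 - ξ`, and `F*(ξ)` is the `F`-length of that minimizer. Uniqueness makes the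
minimizer continuous in all variables (`continuousOn_minimizer`), hence gradients are measurable. As
`F` need not be reversible, convergence in the one-sided norm `F*` is made two-sided on compact sets
by `IsFinslerMetric.exists_reversibility_bound`. -/

/-- Half the square of `f`. -/
def halfSq {E : Type*} (f : E → ℝ) (z : E) : ℝ := (1 / 2 : ℝ) * f z ^ 2

/-- (Not necessarily reversible) Minkowski norms on a normed space. -/
structure IsMinkowskiNorm {E : Type*} [NormedAddCommGroup E] [NormedSpace ℝ E] (f : E → ℝ) :
    Prop where
  nonneg : ∀ y, 0 ≤ f y
  continuous : Continuous f
  smooth : ContDiffOn ℝ 2 f {0}ᶜ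
  homogeneous : ∀ (y : E) (c : ℝ), 0 ≤ c → f (c • y) = c * f y
  posDef : ∀ y : E, y ≠ 0 → ∀ v : E, v ≠ 0 → 0 < fderiv ℝ (fderiv ℝ (halfSq f)) y v v

namespace IsMinkowskiNorm

variable {E : Type*} [NormedAddCommGroup E] [NormedSpace ℝ E] {f : E → ℝ}

theorem map_zero (hf : IsMinkowskiNorm f) : f 0 = 0 := by
  simpa using hf.homogeneous 0 0 le_rfl

theorem contDiffAt_halfSq (hf : IsMinkowskiNorm f) {y : E} (hy : y ≠ 0) :
    ContDiffAt ℝ 2 (halfSq f) y :=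
  contDiffAt_const.mul ((hf.smooth.contDiffAt (isOpen_compl_singleton.mem_nhds hy)).pow 2)

theorem differentiableAt_halfSq (hf : IsMinkowskiNorm f) {y : E} (hy : y ≠ 0) :
    DifferentiableAt ℝ (halfSq f) y :=
  (hf.contDiffAt_halfSq hy).differentiableAt (by norm_num)

theorem differentiableAt_fderiv_halfSq (hf : IsMinkowskiNorm f) {y : E} (hy : y ≠ 0) :
    DifferentiableAt ℝ (fderiv ℝ (halfSq f)) y :=
  ((hf.contDiffAt_halfSq hy).fderiv_right (m := 1) (by norm_num)).differentiableAt (by norm_num)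

theorem halfSq_smul (hf : IsMinkowskiNorm f) (y : E) {c : ℝ} (hc : 0 ≤ c) :
    halfSq f (c • y) = c ^ 2 * halfSq f y := by
  simp only [halfSq, hf.homogeneous y c hc]; ring

/-- Euler's identity for a function homogeneous of degree 2: differentiate along the ray `c • y` at
`c = 1`. -/
theorem fderiv_halfSq_self (hf : IsMinkowskiNorm f) {y : E} (hy : y ≠ 0) :
    fderiv ℝ (halfSq f) y y = f y ^ 2 := by
  have h1 : HasDerivAt (fun c : ℝ => halfSq f (c • y)) (fderiv ℝ (halfSq f) y y) 1 := by
    have h := (hf.differentiableAt_halfSq hy).hasFDerivAt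
    have h2 : HasDerivAt (fun c : ℝ => c • y) y 1 := by
      simpa using (hasDerivAt_id (1 : ℝ)).smul_const y
    have h' : HasFDerivAt (halfSq f) (fderiv ℝ (halfSq f) y) ((1 : ℝ) • y) := by simpa using h
    exact h'.comp_hasDerivAt (1 : ℝ) h2
  have h2 : HasDerivAt (fun c : ℝ => c ^ 2 * halfSq f y) (2 * halfSq f y) 1 := by
    simpa using (hasDerivAt_pow 2 (1 : ℝ)).mul_const (halfSq f y)
  have h3 : (fun c : ℝ => halfSq f (c • y)) =ᶠ[𝓝 1] fun c : ℝ => c ^ 2 * halfSq f y := by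
    filter_upwards [lt_mem_nhds (zero_lt_one' ℝ)] with c hc using hf.halfSq_smul y hc.le
  rw [h1.unique (h2.congr_of_eventuallyEq h3)]
  simp only [halfSq]; ring

theorem fderiv_halfSq_smul (hf : IsMinkowskiNorm f) {y : E} (hy : y ≠ 0) {c : ℝ} (hc : 0 < c) :
    fderiv ℝ (halfSq f) (c • y) = c • fderiv ℝ (halfSq f) y := by
  have h1 : (fun z => halfSq f (c • z)) = fun z => c ^ 2 • halfSq f z := by
    ext z; simp [hf.halfSq_smul z hc.le]
  have h2 := fderiv_comp_smul (𝕜 := ℝ) (f := halfSq f) (x := y) c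
  rw [h1, fderiv_fun_const_smul (hf.differentiableAt_halfSq hy)] at h2
  have h3 : c • (c • fderiv ℝ (halfSq f) y) = c • fderiv ℝ (halfSq f) (c • y) := by
    rw [smul_smul, ← sq]; exact h2
  exact ((smul_right_injective _ hc.ne') h3).symm

/-- Euler's identity again, for the differential, which is homogeneous of degree 1. It identifies
the Legendre transformation `g_y(y, ·)` with the differential of `f²/2` at `y`. -/
theorem fderiv_fderiv_halfSq_self (hf : IsMinkowskiNorm f) {y : E} (hy : y ≠ 0) :
    fderiv ℝ (fderiv ℝ (halfSq f)) y y = fderiv ℝ (halfSq f) y := by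
  have h1 : HasDerivAt (fun c : ℝ => fderiv ℝ (halfSq f) (c • y))
      (fderiv ℝ (fderiv ℝ (halfSq f)) y y) 1 := by
    have h := (hf.differentiableAt_fderiv_halfSq hy).hasFDerivAt
    have h2 : HasDerivAt (fun c : ℝ => c • y) y 1 := by
      simpa using (hasDerivAt_id (1 : ℝ)).smul_const y
    have h' : HasFDerivAt (fderiv ℝ (halfSq f)) (fderiv ℝ (fderiv ℝ (halfSq f)) y)
        ((1 : ℝ) • y) := by simpa using h
    exact h'.comp_hasDerivAt (1 : ℝ) h2
  have h2 : HasDerivAt (fun c : ℝ => c • fderiv ℝ (halfSq f) y) (fderiv ℝ (halfSq f) y) 1 := by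
    simpa using (hasDerivAt_id (1 : ℝ)).smul_const (fderiv ℝ (halfSq f) y)
  have h3 : (fun c : ℝ => fderiv ℝ (halfSq f) (c • y)) =ᶠ[𝓝 1]
      fun c : ℝ => c • fderiv ℝ (halfSq f) y := by
    filter_upwards [lt_mem_nhds (zero_lt_one' ℝ)] with c hc using hf.fderiv_halfSq_smul hy hc
  exact h1.unique (h2.congr_of_eventuallyEq h3)

theorem pos (hf : IsMinkowskiNorm f) {y : E} (hy : y ≠ 0) : 0 < f y := by
  have h := hf.posDef y hy y hy
  rw [hf.fderiv_fderiv_halfSq_self hy, hf.fderiv_halfSq_self hy] at h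
  exact lt_of_le_of_ne (hf.nonneg y) fun h0 => by simp [← h0] at h

/-- `X` minimizes `f² / 2 - ξ`. -/
def IsMinimizer (f : E → ℝ) (ξ : E →L[ℝ] ℝ) (X : E) : Prop :=
  ∀ y, halfSq f X - ξ X ≤ halfSq f y - ξ y

theorem exists_mul_norm_le [FiniteDimensional ℝ E] (hf : IsMinkowskiNorm f) :
    ∃ m > 0, ∀ y, m * ‖y‖ ≤ f y := by
  rcases subsingleton_or_nontrivial E with hE | hE
  · exact ⟨1, one_pos, fun y => by
      rw [Subsingleton.elim y 0]; simp [hf.map_zero]⟩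
  obtain ⟨y₀, hy₀, hmin⟩ := (isCompact_sphere (0 : E) 1).exists_isMinOn
    (NormedSpace.sphere_nonempty.2 zero_le_one) hf.continuous.continuousOn
  have hy₀' : y₀ ≠ 0 := by
    rintro rfl; simp at hy₀
  refine ⟨f y₀, hf.pos hy₀', fun y => ?_⟩
  rcases eq_or_ne y 0 with rfl | hy
  · simp [hf.map_zero]
  have h1 : f y₀ ≤ f (‖y‖⁻¹ • y) := hmin (by simp [norm_smul, hy])
  rw [hf.homogeneous _ _ (by positivity)] at h1
  have h2 : 0 < ‖y‖ := norm_pos_iff.2 hy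
  calc f y₀ * ‖y‖ ≤ ‖y‖⁻¹ * f y * ‖y‖ := by gcongr
    _ = f y := by field_simp

theorem exists_isMinimizer [FiniteDimensional ℝ E] (hf : IsMinkowskiNorm f) (ξ : E →L[ℝ] ℝ) :
    ∃ X, IsMinimizer f ξ X := by
  obtain ⟨m, hm, hle⟩ := hf.exists_mul_norm_le
  have hc : Continuous fun y => halfSq f y - ξ y :=
    (continuous_const.mul (hf.continuous.pow 2)).sub ξ.continuous
  refine hc.exists_forall_le ?_
  have h1 : Tendsto (fun y : E => ‖y‖ * (m ^ 2 / 2 * ‖y‖ - ‖ξ‖)) (cocompact E) atTop := by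
    refine (tendsto_norm_cocompact_atTop (E := E)).atTop_mul_atTop₀ ?_
    refine tendsto_atTop_add_const_right _ _ ?_
    exact (tendsto_norm_cocompact_atTop (E := E)).const_mul_atTop (by positivity)
  refine tendsto_atTop_mono (fun y => ?_) h1
  have h2 : ξ y ≤ ‖ξ‖ * ‖y‖ := (le_abs_self _).trans (ξ.le_opNorm y)
  have h3 : (m * ‖y‖) ^ 2 ≤ f y ^ 2 := by gcongr; exact hle y
  simp only [halfSq]
  nlinarith

theorem IsMinimizer.fderiv_eq {ξ : E →L[ℝ] ℝ} {X : E} (h : IsMinimizer f ξ X)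
    (hf : IsMinkowskiNorm f) (hX : X ≠ 0) : fderiv ℝ (halfSq f) X = ξ := by
  have h1 : IsLocalMin (fun y => halfSq f y - ξ y) X := Eventually.of_forall h
  have h2 := h1.fderiv_eq_zero
  rw [fderiv_fun_sub (hf.differentiableAt_halfSq hX) ξ.differentiableAt,
    ContinuousLinearMap.fderiv] at h2
  exact sub_eq_zero.1 h2

/-- Since `f²/2` is not assumed differentiable at the origin, the critical point equation is
replaced by a comparison with `t • y`: the quadratic term is negligible against the linear one as `t
→ 0`. -/
theorem eq_zero_of_isMinimizer_zero (hf : IsMinkowskiNorm f) {ξ : E →L[ℝ] ℝ}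
    (h : IsMinimizer f ξ 0) : ξ = 0 := by
  have h1 : ∀ y, ξ y ≤ 0 := by
    intro y
    have h2 : ∀ t : ℝ, 0 < t → ξ y ≤ t * halfSq f y := by
      intro t ht
      have h3 := h (t • y)
      rw [hf.halfSq_smul y ht.le] at h3
      simp only [halfSq, hf.map_zero, _root_.map_zero, map_smul, smul_eq_mul] at h3 ⊢
      have h4 : t * ξ y ≤ t * (t * (1 / 2 * f y ^ 2)) := by nlinarith
      exact le_of_mul_le_mul_left h4 ht
    have h3 : Tendsto (fun t : ℝ => t * halfSq f y) (𝓝[>] 0) (𝓝 0) := by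
      have : Tendsto (fun t : ℝ => t * halfSq f y) (𝓝 0) (𝓝 (0 * halfSq f y)) :=
        (continuous_id.mul continuous_const).tendsto 0
      rw [zero_mul] at this
      exact this.mono_left nhdsWithin_le_nhds
    exact ge_of_tendsto h3 (eventually_mem_nhdsWithin.mono h2)
  ext y
  have h2 := h1 (-y)
  rw [map_neg] at h2
  exact le_antisymm (h1 y) (by simpa using h2)

/-- The Legendre transformation of `f`. -/
def leg (f : E → ℝ) (X : E) : E →L[ℝ] ℝ :=
  open Classical in if X = 0 then 0 else fderiv ℝ (fderiv ℝ (halfSq f)) X X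

theorem leg_of_ne (hf : IsMinkowskiNorm f) {X : E} (hX : X ≠ 0) :
    leg f X = fderiv ℝ (halfSq f) X := by
  rw [leg, if_neg hX, hf.fderiv_fderiv_halfSq_self hX]

theorem leg_self (hf : IsMinkowskiNorm f) (X : E) : leg f X X = f X ^ 2 := by
  rcases eq_or_ne X 0 with rfl | hX
  · simp [hf.map_zero]
  · rw [hf.leg_of_ne hX, hf.fderiv_halfSq_self hX]

theorem IsMinimizer.leg_eq {ξ : E →L[ℝ] ℝ} {X : E} (h : IsMinimizer f ξ X)
    (hf : IsMinkowskiNorm f) : leg f X = ξ := by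
  rcases eq_or_ne X 0 with rfl | hX
  · rw [hf.eq_zero_of_isMinimizer_zero h]; simp [leg]
  · rw [hf.leg_of_ne hX, h.fderiv_eq hf hX]

/-- If the segment from `X` to `Y` avoids `0`, positive definiteness makes the directional
derivative of `f²/2` strictly increasing along it, so the differentials at the ends differ. If `(1 -
t) • X + t • Y = 0`, pairing with the common covector gives `(1 - t) f(X)² + t f(Y)² = 0`. This
makes one of the two vectors zero, and then the other. -/
theorem leg_injective (hf : IsMinkowskiNorm f) : Function.Injective (leg f) := by
  intro X Y hXY
  by_contra hne
  by_cases h0 : ∃ t ∈ Icc (0 : ℝ) 1, X + t • (Y - X) = 0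
  · obtain ⟨t, ht, h0⟩ := h0
    have h1 : (1 - t) • X + t • Y = 0 := by rw [← h0]; module
    have h2 : (1 - t) * leg f X X + t * leg f X Y = 0 := by
      have := congrArg (leg f X) h1
      simpa using this
    rw [hXY, hf.leg_self Y, ← hXY, hf.leg_self X] at h2
    have hX2 : 0 ≤ (1 - t) * f X ^ 2 := mul_nonneg (by linarith [ht.2]) (sq_nonneg _)
    have hY2 : 0 ≤ t * f Y ^ 2 := mul_nonneg ht.1 (sq_nonneg _)
    have key : ∀ Z W : E, leg f Z = leg f W → Z = 0 → W = 0 := by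
      rintro Z W hZW rfl
      by_contra hW
      have h3 := hf.leg_self W
      rw [← hZW] at h3
      have := hf.pos hW
      simp only [leg, if_true, zero_apply] at h3
      exact (pow_pos this 2).ne h3
    have hzero : X = 0 ∨ Y = 0 := by
      by_contra hcon
      push Not at hcon
      have hx := pow_pos (hf.pos hcon.1) 2
      have hy := pow_pos (hf.pos hcon.2) 2
      have e1 : t * f Y ^ 2 = 0 := by linarith
      have e2 : (1 - t) * f X ^ 2 = 0 := by linarith
      have e3 : t = 0 := by simpa [hy.ne'] using e1
      rw [e3] at e2
      simp at e2
      exact hx.ne' (by simp [e2])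
    rcases hzero with h | h
    · exact hne (h.trans (key X Y hXY h).symm)
    · exact hne ((key Y X hXY.symm h).trans h.symm)
  · push Not at h0
    have hX : X ≠ 0 := by simpa using h0 0 (by simp)
    have hY : Y ≠ 0 := by simpa using h0 1 (by simp)
    set γ : ℝ → E := fun t => X + t • (Y - X) with hγ
    have hder : ∀ t ∈ Icc (0 : ℝ) 1, HasDerivAt (fun t => fderiv ℝ (halfSq f) (γ t) (Y - X))
        (fderiv ℝ (fderiv ℝ (halfSq f)) (γ t) (Y - X) (Y - X)) t := by
      intro t ht
      have h1 : HasDerivAt γ (Y - X) t := by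
        have := ((hasDerivAt_id t).smul_const (Y - X)).const_add X
        rwa [one_smul] at this
      have h2 := (hf.differentiableAt_fderiv_halfSq (h0 t ht)).hasFDerivAt.comp_hasDerivAt t h1
      simpa using h2.clm_apply (hasDerivAt_const t (Y - X))
    have hmono : StrictMonoOn (fun t => fderiv ℝ (halfSq f) (γ t) (Y - X)) (Icc 0 1) := by
      refine strictMonoOn_of_deriv_pos (convex_Icc 0 1)
        (fun t ht => (hder t ht).continuousAt.continuousWithinAt) fun t ht => ?_
      rw [interior_Icc] at ht
      have ht' := Ioo_subset_Icc_self ht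
      rw [(hder t ht').deriv]
      exact hf.posDef _ (h0 t ht') _ (sub_ne_zero.2 (Ne.symm hne))
    have h1 := hmono (by simp) (by simp) (zero_lt_one' ℝ)
    simp only [hγ, zero_smul, add_zero, one_smul, add_sub_cancel] at h1
    rw [← hf.leg_of_ne hX, ← hf.leg_of_ne hY, hXY] at h1
    exact lt_irrefl _ h1

theorem leg_surjective [FiniteDimensional ℝ E] (hf : IsMinkowskiNorm f) :
    Function.Surjective (leg f) := fun ξ =>
  let ⟨X, hX⟩ := hf.exists_isMinimizer ξ
  ⟨X, hX.leg_eq hf⟩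

/-- No global convexity argument is needed: a minimizer for the covector `leg f X` exists and has
the same Legendre image as `X`, so it is `X` by injectivity. -/
theorem isMinimizer_leg [FiniteDimensional ℝ E] (hf : IsMinkowskiNorm f) (X : E) :
    IsMinimizer f (leg f X) X := by
  obtain ⟨Y, hY⟩ := hf.exists_isMinimizer (leg f X)
  rwa [hf.leg_injective (hY.leg_eq hf)] at hY

theorem leg_apply_le [FiniteDimensional ℝ E] (hf : IsMinkowskiNorm f) (X y : E) :
    leg f X y ≤ f X * f y := by
  rcases eq_or_ne X 0 with rfl | hX
  · simp [leg, hf.map_zero]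
  rcases eq_or_ne y 0 with rfl | hy
  · simp [hf.map_zero]
  -- The competitor is `y` rescaled to the length of `X`, so the quadratic terms cancel and only the
  -- linear ones are compared.
  have h1 := hf.isMinimizer_leg X ((f X / f y) • y)
  have hx := hf.pos hX
  have hy := hf.pos hy
  rw [hf.halfSq_smul y (by positivity), map_smul, hf.leg_self, halfSq, halfSq, smul_eq_mul] at h1
  have h2 : (f X / f y) ^ 2 * (1 / 2 * f y ^ 2) = 1 / 2 * f X ^ 2 := by field_simp
  rw [h2] at h1
  have h3 : f X / f y * leg f X y ≤ f X * f X := by nlinarith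
  have h4 : f X * (leg f X y / f y) ≤ f X * f X := by
    calc f X * (leg f X y / f y) = f X / f y * leg f X y := by ring
      _ ≤ _ := h3
  have h5 := le_of_mul_le_mul_left h4 hx
  rwa [div_le_iff₀ hy] at h5

end IsMinkowskiNorm

end

section

/-! ### The fibres of a Finsler metric -/

variable {n : ℕ} {M : Type*} [TopologicalSpace M] [ChartedSpace (EuclideanSpace ℝ (Fin n)) M]
  [IsManifold (𝓡 n) ∞ M] {F : TangentBundle (𝓡 n) M → ℝ}

/-- The restriction of `F` to the tangent space at `x`. -/
def fiberNorm (F : TangentBundle (𝓡 n) M → ℝ) (x : M) : EuclideanSpace ℝ (Fin n) → ℝ :=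
  fun z => F (⟨x, z⟩ : TangentBundle (𝓡 n) M)

theorem contMDiff_fiberInclusion (x : M) :
    ContMDiff (𝓡 n) (𝓡 n).tangent ∞
      (fun z : EuclideanSpace ℝ (Fin n) => (⟨x, z⟩ : TangentBundle (𝓡 n) M)) := by
  intro z
  rw [Bundle.contMDiffAt_totalSpace]
  refine ⟨contMDiffAt_const, ?_⟩
  have : IsManifold (𝓡 n) 1 M := IsManifold.of_le (n := ∞) (by norm_num)
  simp only [TangentBundle.trivializationAt_apply]
  exact (ContinuousLinearMap.contDiff _).contMDiff.contMDiffAt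

namespace IsFinslerMetric

theorem isMinkowskiNorm (hF : IsFinslerMetric F) (x : M) : IsMinkowskiNorm (fiberNorm F x) where
  nonneg y := hF.nonneg _
  continuous := hF.continuous.comp (contMDiff_fiberInclusion x).continuous
  smooth := by
    have h : ContMDiffOn (𝓡 n) 𝓘(ℝ, ℝ) ∞ (fiberNorm F x) {0}ᶜ :=
      hF.smooth.comp (contMDiff_fiberInclusion x).contMDiffOn fun z hz => hz
    exact (contMDiffOn_iff_contDiffOn.1 h).of_le (WithTop.coe_le_coe.2 (le_top : (2 : ℕ∞) ≤ ⊤))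
  homogeneous y c hc := hF.homogeneous x y c hc
  posDef y hy v hv := hF.posDef x y hy v hv

theorem legendre_eq_leg (x : M) (X : TangentSpace (𝓡 n) x) :
    legendre F x X = IsMinkowskiNorm.leg (fiberNorm F x) X := rfl

theorem legendre_legendreInv (hF : IsFinslerMetric F) (x : M) (ξ : Cotangent n x) :
    legendre F x (legendreInv F x ξ) = ξ :=
  Function.invFun_eq ((hF.isMinkowskiNorm x).leg_surjective ξ)

theorem legendreInv_legendre (hF : IsFinslerMetric F) (x : M) (X : TangentSpace (𝓡 n) x) :
    legendreInv F x (legendre F x X) = X :=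
  (hF.isMinkowskiNorm x).leg_injective (hF.legendre_legendreInv x (legendre F x X))

/-- This description of the gradient involves only values of `F`. It therefore transforms trivially
under linear changes of coordinates and passes to limits. -/
theorem isMinimizer_iff (hF : IsFinslerMetric F) {x : M} {ξ : Cotangent n x}
    {X : TangentSpace (𝓡 n) x} :
    IsMinkowskiNorm.IsMinimizer (fiberNorm F x) ξ X ↔ X = legendreInv F x ξ := by
  constructor
  · intro h
    have h1 : legendre F x X = ξ := h.leg_eq (hF.isMinkowskiNorm x)
    rw [← h1, hF.legendreInv_legendre]
  · rintro rfl
    have := (hF.isMinkowskiNorm x).isMinimizer_leg (legendreInv F x ξ)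
    rwa [← legendre_eq_leg, hF.legendre_legendreInv] at this

theorem apply_legendreInv (hF : IsFinslerMetric F) (x : M) (ξ : Cotangent n x) :
    ξ (legendreInv F x ξ) = F ⟨x, legendreInv F x ξ⟩ ^ 2 := by
  have := (hF.isMinkowskiNorm x).leg_self (legendreInv F x ξ)
  rwa [← legendre_eq_leg, hF.legendre_legendreInv] at this

theorem apply_le_mul (hF : IsFinslerMetric F) (x : M) (ξ : Cotangent n x)
    (y : TangentSpace (𝓡 n) x) : ξ y ≤ F ⟨x, legendreInv F x ξ⟩ * F ⟨x, y⟩ := by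
  have := (hF.isMinkowskiNorm x).leg_apply_le (legendreInv F x ξ) y
  rwa [← legendre_eq_leg, hF.legendre_legendreInv] at this

theorem map_zero (hF : IsFinslerMetric F) (x : M) : F ⟨x, (0 : TangentSpace (𝓡 n) x)⟩ = 0 :=
  (hF.isMinkowskiNorm x).map_zero

theorem pos (hF : IsFinslerMetric F) {x : M} {y : TangentSpace (𝓡 n) x} (hy : y ≠ 0) :
    0 < F ⟨x, y⟩ :=
  (hF.isMinkowskiNorm x).pos hy

theorem dualMetric_eq (hF : IsFinslerMetric F) (x : M) (ξ : Cotangent n x) :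
    dualMetric F x ξ = F ⟨x, legendreInv F x ξ⟩ := by
  have hle : ∀ y : {y : TangentSpace (𝓡 n) x // y ≠ 0},
      ξ y.1 / F ⟨x, y.1⟩ ≤ F ⟨x, legendreInv F x ξ⟩ := fun y => by
    rw [div_le_iff₀ (hF.pos y.2)]
    exact hF.apply_le_mul x ξ y.1
  -- In the first case `ξ = 0` and the supremum is `0`, also when `n = 0` and the index type is
  -- empty. Otherwise the supremum is attained at the gradient itself.
  rcases eq_or_ne (legendreInv F x ξ) 0 with h0 | h0
  · have h1 : ξ = 0 := by
      rw [← hF.legendre_legendreInv x ξ, h0]; simp [legendre]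
    rw [h0, hF.map_zero, h1]
    simp [dualMetric]
  · have : Nonempty {y : TangentSpace (𝓡 n) x // y ≠ 0} := ⟨⟨_, h0⟩⟩
    refine le_antisymm (ciSup_le hle) ?_
    have h1 := le_ciSup (f := fun y : {y : TangentSpace (𝓡 n) x // y ≠ 0} =>
      ξ y.1 / F ⟨x, y.1⟩) ⟨_, forall_mem_range.2 hle⟩ ⟨_, h0⟩
    refine le_trans ?_ h1
    simp only [hF.apply_legendreInv]
    rw [sq, mul_div_assoc, div_self (hF.pos h0).ne', mul_one]

theorem dualMetric_nonneg (hF : IsFinslerMetric F) (x : M) (ξ : Cotangent n x) :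
    0 ≤ dualMetric F x ξ := by
  rw [hF.dualMetric_eq]; exact hF.nonneg _

theorem apply_le_dualMetric_mul (hF : IsFinslerMetric F) (x : M) (ξ : Cotangent n x)
    (y : TangentSpace (𝓡 n) x) : ξ y ≤ dualMetric F x ξ * F ⟨x, y⟩ := by
  rw [hF.dualMetric_eq]; exact hF.apply_le_mul x ξ y

theorem dualMetric_le (hF : IsFinslerMetric F) {x : M} {ξ : Cotangent n x} {C : ℝ} (hC : 0 ≤ C)
    (h : ∀ y : TangentSpace (𝓡 n) x, ξ y ≤ C * F ⟨x, y⟩) : dualMetric F x ξ ≤ C :=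
  Real.iSup_le (fun y => by rw [div_le_iff₀ (hF.pos y.2)]; exact h y.1) hC

theorem dualMetric_add_le (hF : IsFinslerMetric F) (x : M) (ξ η : Cotangent n x) :
    dualMetric F x (ξ + η) ≤ dualMetric F x ξ + dualMetric F x η :=
  hF.dualMetric_le (add_nonneg (hF.dualMetric_nonneg x ξ) (hF.dualMetric_nonneg x η)) fun y => by
    rw [add_apply, add_mul]
    exact add_le_add (hF.apply_le_dualMetric_mul x ξ y) (hF.apply_le_dualMetric_mul x η y)

/-- The maximum in the theorem originates here: without reversibility a bound of `|ξ y|` needs both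
`F*(ξ)` and `F*(-ξ)`. -/
theorem abs_apply_le (hF : IsFinslerMetric F) (x : M) (ξ : Cotangent n x)
    (y : TangentSpace (𝓡 n) x) :
    |ξ y| ≤ max (dualMetric F x ξ) (dualMetric F x (-ξ)) * F ⟨x, y⟩ := by
  have h1 := hF.apply_le_dualMetric_mul x ξ y
  have h2 := hF.apply_le_dualMetric_mul x (-ξ) y
  rw [neg_apply] at h2
  refine abs_le'.2 ⟨h1.trans ?_, h2.trans ?_⟩
  · exact mul_le_mul_of_nonneg_right (le_max_left _ _) (hF.nonneg _)
  · exact mul_le_mul_of_nonneg_right (le_max_right _ _) (hF.nonneg _)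

theorem dualMetric_neg_le (hF : IsFinslerMetric F) {x : M} {C : ℝ} (hC : 0 ≤ C)
    (h : ∀ y : TangentSpace (𝓡 n) x, F ⟨x, -y⟩ ≤ C * F ⟨x, y⟩) (ξ : Cotangent n x) :
    dualMetric F x (-ξ) ≤ C * dualMetric F x ξ :=
  hF.dualMetric_le (mul_nonneg hC (hF.dualMetric_nonneg x ξ)) fun y => by
    have h1 := hF.apply_le_dualMetric_mul x ξ (-y)
    rw [map_neg] at h1
    calc (-ξ) y = -ξ y := rfl
      _ ≤ dualMetric F x ξ * F ⟨x, -y⟩ := h1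
      _ ≤ dualMetric F x ξ * (C * F ⟨x, y⟩) :=
        mul_le_mul_of_nonneg_left (h y) (hF.dualMetric_nonneg x ξ)
      _ = _ := by ring

end IsFinslerMetric

end

section

/-! ### Continuous families of positive homogeneous functions -/

section Families

variable {Z E : Type*} [TopologicalSpace Z] [LocallyCompactSpace Z] [NormedAddCommGroup E]
  [NormedSpace ℝ E] [FiniteDimensional ℝ E] {T : Set Z} {Φ : Z → E → ℝ}

/-- Take the extrema over a compact neighbourhood times the unit sphere and extend by homogeneity.
-/
theorem exists_nhds_bounds (hT : IsOpen T)
    (hc : ContinuousOn (fun q : Z × E => Φ q.1 q.2) (T ×ˢ univ))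
    (hpos : ∀ z ∈ T, ∀ w, w ≠ 0 → 0 < Φ z w)
    (hhom : ∀ z ∈ T, ∀ w, ∀ c : ℝ, 0 ≤ c → Φ z (c • w) = c * Φ z w) {z₀ : Z} (hz₀ : z₀ ∈ T) :
    ∃ V ∈ 𝓝 z₀, V ⊆ T ∧ ∃ m > 0, ∃ C > 0, ∀ z ∈ V, ∀ w, m * ‖w‖ ≤ Φ z w ∧ Φ z w ≤ C * ‖w‖ := by
  obtain ⟨K, hK, hKT, hKc⟩ := local_compact_nhds (hT.mem_nhds hz₀)
  have hcomp : IsCompact (K ×ˢ Metric.sphere (0 : E) 1) := hKc.prod (isCompact_sphere _ _)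
  have hc' : ContinuousOn (fun q : Z × E => Φ q.1 q.2) (K ×ˢ Metric.sphere (0 : E) 1) :=
    hc.mono (prod_mono hKT (subset_univ _))
  obtain ⟨m, hm, hmle⟩ := hcomp.exists_forall_le' hc' (a := 0) fun q hq =>
    hpos _ (hKT hq.1) _ fun h => by
      have := hq.2
      simp [h] at this
  obtain ⟨C, hC⟩ := hcomp.exists_bound_of_continuousOn hc'
  refine ⟨K, hK, hKT, m, hm, max C 1, by positivity, fun z hz w => ?_⟩
  rcases eq_or_ne w 0 with rfl | hw
  · have := hhom z (hKT hz) 0 0 le_rfl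
    simp only [smul_zero, zero_mul] at this
    simp [this]
  have hw' : 0 < ‖w‖ := norm_pos_iff.2 hw
  have hmem : (z, ‖w‖⁻¹ • w) ∈ K ×ˢ Metric.sphere (0 : E) 1 :=
    ⟨hz, by simp [norm_smul, hw]⟩
  have h1 := hmle _ hmem
  have h2 := (le_abs_self _).trans ((hC _ hmem).trans (le_max_left C 1))
  have h3 : Φ z w = ‖w‖ * Φ z (‖w‖⁻¹ • w) := by
    rw [← hhom z (hKT hz) _ _ hw'.le, smul_smul, mul_inv_cancel₀ hw'.ne', one_smul]
  rw [h3, mul_comm m, mul_comm (max C 1)]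
  exact ⟨by gcongr, by gcongr⟩

/-- Near a given point the minimizers stay in one compact ball, and every cluster point of them is a
minimizer of the limit problem. Uniqueness of that minimizer gives convergence. -/
theorem continuousOn_minimizer (hT : IsOpen T)
    (hc : ContinuousOn (fun q : Z × E => Φ q.1 q.2) (T ×ˢ univ))
    (hpos : ∀ z ∈ T, ∀ w, w ≠ 0 → 0 < Φ z w)
    (hhom : ∀ z ∈ T, ∀ w, ∀ c : ℝ, 0 ≤ c → Φ z (c • w) = c * Φ z w)
    {W : Z → (E →L[ℝ] ℝ) → E}
    (hW : ∀ z ∈ T, ∀ ζ w, IsMinkowskiNorm.IsMinimizer (Φ z) ζ w ↔ w = W z ζ) :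
    ContinuousOn (fun q : Z × (E →L[ℝ] ℝ) => W q.1 q.2) (T ×ˢ univ) := by
  rintro ⟨z₀, ζ₀⟩ ⟨hz₀, -⟩
  refine ContinuousAt.continuousWithinAt ?_
  obtain ⟨V, hV, hVT, m, hm, C, -, hb⟩ := exists_nhds_bounds hT hc hpos hhom hz₀
  have hev : ∀ᶠ q : Z × (E →L[ℝ] ℝ) in 𝓝 (z₀, ζ₀), q.1 ∈ V ∧ ‖q.2‖ ≤ ‖ζ₀‖ + 1 := by
    refine (continuous_fst.continuousAt.eventually hV).and ?_
    exact (continuous_snd.norm.continuousAt (x := (z₀, ζ₀))).eventually_le_const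
      (by simp : ‖((z₀, ζ₀) : Z × (E →L[ℝ] ℝ)).2‖ < ‖ζ₀‖ + 1)
  have hmin : ∀ z ∈ T, ∀ ζ, IsMinkowskiNorm.IsMinimizer (Φ z) ζ (W z ζ) :=
    fun z hz ζ => (hW z hz ζ _).2 rfl
  -- The radius comes from comparing the minimizer `w` with `0`: `m² ‖w‖² / 2 ≤ ‖ζ‖ * ‖w‖`, where
  -- `‖ζ‖ ≤ ‖ζ₀‖ + 1`.
  refine IsCompact.tendsto_nhds_of_unique_mapClusterPt
    (isCompact_closedBall (0 : E) (2 * (‖ζ₀‖ + 1) / m ^ 2)) ?_ ?_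
  · filter_upwards [hev] with q ⟨hq1, hq2⟩
    have h1 := hmin q.1 (hVT hq1) q.2 0
    have h0 := hhom q.1 (hVT hq1) 0 0 le_rfl
    simp only [smul_zero, zero_mul] at h0
    simp only [halfSq, h0, _root_.map_zero] at h1
    set w := W q.1 q.2
    have h2 := (hb q.1 hq1 w).1
    have h3 : q.2 w ≤ (‖ζ₀‖ + 1) * ‖w‖ :=
      (le_abs_self _).trans ((q.2.le_opNorm w).trans (by gcongr))
    have h4 : (m * ‖w‖) ^ 2 ≤ Φ q.1 w ^ 2 := by gcongr
    rw [mem_closedBall_zero_iff, le_div_iff₀ (by positivity)]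
    rcases (norm_nonneg w).eq_or_lt with h5 | h5
    · rw [← h5]; simp; positivity
    · have h6 : ‖w‖ * (‖w‖ * m ^ 2) ≤ ‖w‖ * (2 * (‖ζ₀‖ + 1)) := by nlinarith
      exact le_of_mul_le_mul_left h6 h5
  · intro y _ hy
    rw [mapClusterPt_iff_ultrafilter] at hy
    obtain ⟨U, hU, hUy⟩ := hy
    refine (hW z₀ hz₀ ζ₀ y).1 fun v => ?_
    have hfst : Tendsto (fun q : Z × (E →L[ℝ] ℝ) => q.1) U (𝓝 z₀) :=
      continuous_fst.continuousAt.tendsto.mono_left hU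
    have hsnd : Tendsto (fun q : Z × (E →L[ℝ] ℝ) => q.2) U (𝓝 ζ₀) :=
      (continuous_snd.continuousAt (x := (z₀, ζ₀))).tendsto.mono_left hU
    have key : ∀ (g : Z × (E →L[ℝ] ℝ) → E) (g₀ : E), Tendsto g U (𝓝 g₀) →
        Tendsto (fun q : Z × (E →L[ℝ] ℝ) => halfSq (Φ q.1) (g q) - q.2 (g q)) U
          (𝓝 (halfSq (Φ z₀) g₀ - ζ₀ g₀)) := by
      intro g g₀ hg
      have h1 : ContinuousAt (fun q : Z × E => Φ q.1 q.2) (z₀, g₀) :=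
        hc.continuousAt ((hT.prod isOpen_univ).mem_nhds ⟨hz₀, mem_univ _⟩)
      have h2 : Tendsto (fun q : Z × (E →L[ℝ] ℝ) => Φ q.1 (g q)) U (𝓝 (Φ z₀ g₀)) :=
        h1.tendsto.comp (hfst.prodMk_nhds hg)
      have h3 : Tendsto (fun q : Z × (E →L[ℝ] ℝ) => q.2 (g q)) U (𝓝 (ζ₀ g₀)) :=
        (isBoundedBilinearMap_apply (𝕜 := ℝ) (E := E) (F := ℝ)).continuous.continuousAt.tendsto.comp
          (hsnd.prodMk_nhds hg)
      exact ((h2.pow 2).const_mul _).sub h3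
    refine le_of_tendsto_of_tendsto (key _ y hUy) (key _ v tendsto_const_nhds) ?_
    filter_upwards [hU hev] with q hq using hmin q.1 (hVT hq.1) q.2 v

end Families

/-! ### Finsler metrics in charts -/

variable {n : ℕ} {M : Type*} [TopologicalSpace M] [ChartedSpace (EuclideanSpace ℝ (Fin n)) M]
  [IsManifold (𝓡 n) ∞ M] {F : TangentBundle (𝓡 n) M → ℝ}
  {e : OpenPartialHomeomorph M (EuclideanSpace ℝ (Fin n))}

/-- The coordinate frame of the chart `e` at `x`. -/
def chartFrame (e : OpenPartialHomeomorph M (EuclideanSpace ℝ (Fin n))) (x : M) :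
    EuclideanSpace ℝ (Fin n) →L[ℝ] TangentSpace (𝓡 n) x :=
  (mfderiv (𝓡 n) (𝓡 n) e.symm (e x) :)

theorem chartFrame_comp_mfderiv (he : e ∈ atlas (EuclideanSpace ℝ (Fin n)) M) {x : M}
    (hx : x ∈ e.source) (v : TangentSpace (𝓡 n) x) :
    chartFrame e x (mfderiv (𝓡 n) (𝓡 n) e x v) = v := by
  have : IsManifold (𝓡 n) 1 M := IsManifold.of_le (n := ∞) (by norm_num)
  have h := (mdifferentiable_of_mem_atlas (I := 𝓡 n) he).symm_comp_deriv hx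
  exact DFunLike.congr_fun h v

theorem chartFrame_surjective (he : e ∈ atlas (EuclideanSpace ℝ (Fin n)) M) {x : M}
    (hx : x ∈ e.source) : Function.Surjective (chartFrame e x) := fun v =>
  ⟨_, chartFrame_comp_mfderiv he hx v⟩

theorem chartFrame_injective (he : e ∈ atlas (EuclideanSpace ℝ (Fin n)) M) {x : M}
    (hx : x ∈ e.source) : Function.Injective (chartFrame e x) :=
  LinearMap.injective_iff_surjective (K := ℝ) (V := EuclideanSpace ℝ (Fin n))
    (f := (chartFrame e x).toLinearMap) |>.2 (chartFrame_surjective he hx)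

theorem chartMetric_apply {x : M} (hx : x ∈ e.source) (w : EuclideanSpace ℝ (Fin n)) :
    chartMetric F e (e x) w = F ⟨x, chartFrame e x w⟩ := by
  -- The points `e.symm (e x)` and `x` are only propositionally equal. Stating the transport for
  -- vectors of the model space avoids casts between tangent spaces.
  have h : ∀ x' : M, x' = x → ∀ v : EuclideanSpace ℝ (Fin n),
      fiberNorm F x' v = fiberNorm F x v := by
    rintro _ rfl v; rfl
  exact h _ (e.left_inv hx) _

/-- In a chart, `F` is its composition with the tangent map of `e.symm`, which is continuous. -/
theorem continuousOn_chartMetric (hF : Continuous F)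
    (he : e ∈ atlas (EuclideanSpace ℝ (Fin n)) M) :
    ContinuousOn (fun q : EuclideanSpace ℝ (Fin n) × EuclideanSpace ℝ (Fin n) =>
      chartMetric F e q.1 q.2) (e.target ×ˢ univ) := by
  have : IsManifold (𝓡 n) 1 M := IsManifold.of_le (n := ∞) (by norm_num)
  have h1 : ContMDiffOn (𝓡 n) (𝓡 n) ∞ e.symm e.target :=
    contMDiffOn_symm_of_mem_maximalAtlas (IsManifold.subset_maximalAtlas he)
  have h2 := h1.continuousOn_tangentMapWithin (by norm_num) e.open_target.uniqueMDiffOn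
  have h3 : ContinuousOn (fun q : EuclideanSpace ℝ (Fin n) × EuclideanSpace ℝ (Fin n) =>
      tangentMapWithin (𝓡 n) (𝓡 n) e.symm e.target
        ((tangentBundleModelSpaceHomeomorph (𝓡 n)).symm q)) (e.target ×ˢ univ) :=
    h2.comp (tangentBundleModelSpaceHomeomorph (𝓡 n)).symm.continuous.continuousOn
      fun q hq => hq.1
  refine (hF.comp_continuousOn h3).congr fun q hq => ?_
  have h4 : mfderivWithin (𝓡 n) (𝓡 n) e.symm e.target q.1 = mfderiv (𝓡 n) (𝓡 n) e.symm q.1 :=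
    mfderivWithin_of_isOpen e.open_target hq.1
  change _ = F ⟨e.symm q.1, mfderivWithin (𝓡 n) (𝓡 n) e.symm e.target q.1 q.2⟩
  rw [h4]
  rfl

/-- The components in the chart `e` of the inverse of the Legendre transformation. -/
def chartGrad (F : TangentBundle (𝓡 n) M → ℝ)
    (e : OpenPartialHomeomorph M (EuclideanSpace ℝ (Fin n)))
    (z : EuclideanSpace ℝ (Fin n)) (ζ : EuclideanSpace ℝ (Fin n) →L[ℝ] ℝ) :
    EuclideanSpace ℝ (Fin n) :=
  Classical.epsilon (IsMinkowskiNorm.IsMinimizer (chartMetric F e z) ζ)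

namespace IsFinslerMetric

theorem chartMetric_pos (hF : IsFinslerMetric F) (he : e ∈ atlas (EuclideanSpace ℝ (Fin n)) M) :
    ∀ z ∈ e.target, ∀ w, w ≠ 0 → 0 < chartMetric F e z w := by
  intro z hz w hw
  obtain ⟨x, hx, rfl⟩ : ∃ x ∈ e.source, e x = z := ⟨e.symm z, e.map_target hz, e.right_inv hz⟩
  rw [chartMetric_apply hx]
  refine hF.pos fun h => hw ?_
  exact chartFrame_injective he hx (h.trans (_root_.map_zero (chartFrame e x)).symm)

theorem chartMetric_smul (hF : IsFinslerMetric F) :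
    ∀ z ∈ e.target, ∀ w, ∀ c : ℝ, 0 ≤ c → chartMetric F e z (c • w) = c * chartMetric F e z w := by
  intro z hz w c hc
  obtain ⟨x, hx, rfl⟩ : ∃ x ∈ e.source, e x = z := ⟨e.symm z, e.map_target hz, e.right_inv hz⟩
  rw [chartMetric_apply hx, chartMetric_apply hx, map_smul, hF.homogeneous x _ c hc]

theorem isMinimizer_chartMetric_iff (hF : IsFinslerMetric F)
    (he : e ∈ atlas (EuclideanSpace ℝ (Fin n)) M) {x : M} (hx : x ∈ e.source)
    (ξ : Cotangent n x) (w : EuclideanSpace ℝ (Fin n)) :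
    IsMinkowskiNorm.IsMinimizer (chartMetric F e (e x)) (ξ.comp (chartFrame e x)) w ↔
      chartFrame e x w = legendreInv F x ξ := by
  rw [← hF.isMinimizer_iff]
  constructor
  · intro h y
    obtain ⟨v, rfl⟩ := chartFrame_surjective he hx y
    have := h v
    simp only [halfSq, chartMetric_apply hx] at this
    exact this
  · intro h v
    have := h (chartFrame e x v)
    simp only [halfSq, chartMetric_apply hx]
    exact this

theorem isMinimizer_chartMetric_iff_eq (hF : IsFinslerMetric F)
    (he : e ∈ atlas (EuclideanSpace ℝ (Fin n)) M) :
    ∀ z ∈ e.target, ∀ ζ w, IsMinkowskiNorm.IsMinimizer (chartMetric F e z) ζ w ↔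
      w = chartGrad F e z ζ := by
  intro z hz ζ w
  obtain ⟨x, hx, rfl⟩ : ∃ x ∈ e.source, e x = z := ⟨e.symm z, e.map_target hz, e.right_inv hz⟩
  obtain ⟨ξ, rfl⟩ : ∃ ξ : Cotangent n x, ξ.comp (chartFrame e x) = ζ := by
    refine ⟨ζ.comp (mfderiv (𝓡 n) (𝓡 n) e x), ?_⟩
    ext v
    have : mfderiv (𝓡 n) (𝓡 n) e x (chartFrame e x v) = v :=
      chartFrame_injective he hx (chartFrame_comp_mfderiv he hx _)
    exact congrArg ζ this
  have huniq : ∀ w w', IsMinkowskiNorm.IsMinimizer (chartMetric F e (e x))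
      (ξ.comp (chartFrame e x)) w → IsMinkowskiNorm.IsMinimizer (chartMetric F e (e x))
      (ξ.comp (chartFrame e x)) w' → w = w' := by
    intro w w' h h'
    rw [hF.isMinimizer_chartMetric_iff he hx] at h h'
    exact chartFrame_injective he hx (h.trans h'.symm)
  have hex : ∃ w, IsMinkowskiNorm.IsMinimizer (chartMetric F e (e x))
      (ξ.comp (chartFrame e x)) w := by
    obtain ⟨w, hw⟩ := chartFrame_surjective he hx (legendreInv F x ξ)
    exact ⟨w, (hF.isMinimizer_chartMetric_iff he hx ξ w).2 hw⟩
  have hspec := Classical.epsilon_spec hex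
  exact ⟨fun h => huniq _ _ h hspec, fun h => h ▸ hspec⟩

theorem chartFrame_chartGrad (hF : IsFinslerMetric F)
    (he : e ∈ atlas (EuclideanSpace ℝ (Fin n)) M) {x : M} (hx : x ∈ e.source)
    (ξ : Cotangent n x) :
    chartFrame e x (chartGrad F e (e x) (ξ.comp (chartFrame e x))) = legendreInv F x ξ :=
  (hF.isMinimizer_chartMetric_iff he hx ξ _).1
    ((hF.isMinimizer_chartMetric_iff_eq he _ (e.map_source hx) _ _).2 rfl)

theorem continuousOn_chartGrad (hF : IsFinslerMetric F)
    (he : e ∈ atlas (EuclideanSpace ℝ (Fin n)) M) :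
    ContinuousOn (fun q : EuclideanSpace ℝ (Fin n) × (EuclideanSpace ℝ (Fin n) →L[ℝ] ℝ) =>
      chartGrad F e q.1 q.2) (e.target ×ˢ univ) :=
  continuousOn_minimizer e.open_target (continuousOn_chartMetric hF.continuous he)
    (hF.chartMetric_pos he) hF.chartMetric_smul (hF.isMinimizer_chartMetric_iff_eq he)

theorem dualMetric_eq_chart (hF : IsFinslerMetric F)
    (he : e ∈ atlas (EuclideanSpace ℝ (Fin n)) M) {x : M} (hx : x ∈ e.source)
    (ξ : Cotangent n x) :
    dualMetric F x ξ =
      chartMetric F e (e x) (chartGrad F e (e x) (ξ.comp (chartFrame e x))) := by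
  rw [hF.dualMetric_eq, chartMetric_apply hx, hF.chartFrame_chartGrad he hx]

end IsFinslerMetric

end

section

/-! ### Measurability of gradients -/

/-- The image measure of `μ` under `k` is carried by `S`, so continuity of `H` on `S` suffices. -/
theorem aemeasurable_comp_of_continuousOn {X Y Z : Type*} [MeasurableSpace X]
    [TopologicalSpace Y] [MeasurableSpace Y] [BorelSpace Y]
    [TopologicalSpace Z] [TopologicalSpace.PseudoMetrizableSpace Z] [MeasurableSpace Z]
    [BorelSpace Z] {μ : Measure X} {H : Y → Z} {k : X → Y} {S : Set Y} (hS : MeasurableSet S)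
    (hH : ContinuousOn H S) (hk : AEMeasurable k μ) (hkS : ∀ᵐ x ∂μ, k x ∈ S) :
    AEMeasurable (fun x => H (k x)) μ := by
  have h1 : AEMeasurable H ((μ.map k).restrict S) := hH.aemeasurable hS
  rw [Measure.restrict_eq_self_of_ae_mem ((ae_map_iff hk hS).2 hkS)] at h1
  exact h1.comp_aemeasurable hk

section

variable {n : ℕ} {M : Type*} [TopologicalSpace M] [ChartedSpace (EuclideanSpace ℝ (Fin n)) M]
  {e : OpenPartialHomeomorph M (EuclideanSpace ℝ (Fin n))}
  [MeasurableSpace M] [BorelSpace M] {𝔪 : Measure M} {Ω U : Set M}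

theorem aemeasurable_restrict_of_charts [SecondCountableTopology M] {g : M → ℝ}
    (h : ∀ e ∈ atlas (EuclideanSpace ℝ (Fin n)) M, AEMeasurable g (𝔪.restrict (e.source ∩ Ω))) :
    AEMeasurable g (𝔪.restrict Ω) := by
  obtain ⟨s, hs, hcov⟩ := TopologicalSpace.countable_cover_nhds
    fun x : M => (chart_source_mem_nhds (EuclideanSpace ℝ (Fin n)) x)
  have h1 : Ω = ⋃ x ∈ s, ((chartAt (EuclideanSpace ℝ (Fin n)) x).source ∩ Ω) := by
    rw [← iUnion₂_inter, hcov, univ_inter]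
  have := hs.to_subtype
  rw [h1, biUnion_eq_iUnion, aemeasurable_iUnion_iff]
  exact fun x => h _ (chart_mem_atlas _ x.1)

theorem aemeasurable_chart : AEMeasurable e (𝔪.restrict (e.source ∩ Ω)) :=
  (e.continuousOn.aemeasurable e.open_source.measurableSet).mono_measure
    (Measure.restrict_mono inter_subset_left le_rfl)

theorem IsMeasurableCovectorField.aemeasurable_comp_chartFrame
    {η : (x : M) → Cotangent n x} (hη : IsMeasurableCovectorField 𝔪 Ω η)
    (he : e ∈ atlas (EuclideanSpace ℝ (Fin n)) M) :
    AEMeasurable (fun x => (η x).comp (chartFrame e x)) (𝔪.restrict (e.source ∩ Ω)) := by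
  have h1 : (fun x => (η x).comp (chartFrame e x)) = fun x => ∑ i : Fin n,
      (η x (chartFrame e x (EuclideanSpace.single i 1))) •
        (EuclideanSpace.proj i : EuclideanSpace ℝ (Fin n) →L[ℝ] ℝ) := by
    funext x
    ext v
    have hv : v = ∑ i, v i • EuclideanSpace.single i (1 : ℝ) := by
      ext j
      simp [Pi.single_apply]
    conv_lhs => rw [hv]
    simp [map_sum, mul_comm]
  rw [h1]
  exact Finset.aemeasurable_fun_sum _ fun i _ =>
    (hη e he (EuclideanSpace.single i 1)).smul_const _

theorem IsMeasurableCovectorField.mono {η : (x : M) → Cotangent n x}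
    (hη : IsMeasurableCovectorField 𝔪 Ω η) (hU : U ⊆ Ω) : IsMeasurableCovectorField 𝔪 U η :=
  fun e he v => (hη e he v).mono_measure
    (Measure.restrict_mono (inter_subset_inter_right _ hU) le_rfl)

theorem IsMeasurableCovectorField.neg {η : (x : M) → Cotangent n x}
    (hη : IsMeasurableCovectorField 𝔪 Ω η) : IsMeasurableCovectorField 𝔪 Ω fun x => -η x :=
  fun e he v => (hη e he v).neg

theorem IsMeasurableCovectorField.sub {η θ : (x : M) → Cotangent n x}
    (hη : IsMeasurableCovectorField 𝔪 Ω η) (hθ : IsMeasurableCovectorField 𝔪 Ω θ) :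
    IsMeasurableCovectorField 𝔪 Ω fun x => η x - θ x :=
  fun e he v => (hη e he v).sub (hθ e he v)

variable [IsManifold (𝓡 n) ∞ M] {F : TangentBundle (𝓡 n) M → ℝ}

theorem IsMeasurableCovectorField.aemeasurable_chartGrad {η : (x : M) → Cotangent n x}
    (hη : IsMeasurableCovectorField 𝔪 Ω η) (hΩ : MeasurableSet Ω) (hF : IsFinslerMetric F)
    (he : e ∈ atlas (EuclideanSpace ℝ (Fin n)) M) :
    AEMeasurable (fun x => chartGrad F e (e x) ((η x).comp (chartFrame e x)))
      (𝔪.restrict (e.source ∩ Ω)) :=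
  aemeasurable_comp_of_continuousOn
    (k := fun x => (e x, (η x).comp (chartFrame e x)))
    (e.open_target.prod isOpen_univ).measurableSet
    (hF.continuousOn_chartGrad he) (aemeasurable_chart.prodMk (hη.aemeasurable_comp_chartFrame he))
    ((ae_restrict_mem (e.open_source.measurableSet.inter hΩ)).mono
      fun _ hx => ⟨e.map_source hx.1, mem_univ _⟩)

theorem IsMeasurableCovectorField.aemeasurable_dualMetric [SecondCountableTopology M]
    {η : (x : M) → Cotangent n x}
    (hη : IsMeasurableCovectorField 𝔪 Ω η) (hΩ : MeasurableSet Ω) (hF : IsFinslerMetric F) :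
    AEMeasurable (fun x => dualMetric F x (η x)) (𝔪.restrict Ω) := by
  refine aemeasurable_restrict_of_charts (n := n) fun e he => ?_
  have hmem := ae_restrict_mem (μ := 𝔪) (e.open_source.measurableSet.inter hΩ)
  have h1 : AEMeasurable (fun x => chartMetric F e (e x)
      (chartGrad F e (e x) ((η x).comp (chartFrame e x)))) (𝔪.restrict (e.source ∩ Ω)) :=
    aemeasurable_comp_of_continuousOn
      (k := fun x => (e x, chartGrad F e (e x) ((η x).comp (chartFrame e x))))
      (e.open_target.prod isOpen_univ).measurableSet
      (continuousOn_chartMetric hF.continuous he)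
      (aemeasurable_chart.prodMk (hη.aemeasurable_chartGrad hΩ hF he))
      (hmem.mono fun _ hx => ⟨e.map_source hx.1, mem_univ _⟩)
  exact h1.congr (hmem.mono fun x (hx : x ∈ e.source ∩ Ω) =>
    (hF.dualMetric_eq_chart he hx.1 (η x)).symm)

theorem IsMeasurableCovectorField.aemeasurable_apply_legendreInv [SecondCountableTopology M]
    {η θ : (x : M) → Cotangent n x} (hθ : IsMeasurableCovectorField 𝔪 Ω θ)
    (hη : IsMeasurableCovectorField 𝔪 Ω η) (hΩ : MeasurableSet Ω) (hF : IsFinslerMetric F) :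
    AEMeasurable (fun x => θ x (legendreInv F x (η x))) (𝔪.restrict Ω) := by
  refine aemeasurable_restrict_of_charts (n := n) fun e he => ?_
  have hmem := ae_restrict_mem (μ := 𝔪) (e.open_source.measurableSet.inter hΩ)
  have h1 : AEMeasurable (fun x => ((θ x).comp (chartFrame e x))
      (chartGrad F e (e x) ((η x).comp (chartFrame e x)))) (𝔪.restrict (e.source ∩ Ω)) :=
    (isBoundedBilinearMap_apply (𝕜 := ℝ) (E := EuclideanSpace ℝ (Fin n))
      (F := ℝ)).continuous.measurable.comp_aemeasurable
      ((hθ.aemeasurable_comp_chartFrame he).prodMk (hη.aemeasurable_chartGrad hΩ hF he))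
  exact h1.congr (hmem.mono fun x hx => congrArg (θ x) (hF.chartFrame_chartGrad he hx.1 (η x)))

/-! ### Differentials of `C¹` functions -/

theorem differential_comp_chartFrame {φ : M → ℝ} {x : M}
    (he : e ∈ atlas (EuclideanSpace ℝ (Fin n)) M) (hx : x ∈ e.source)
    (hφ : MDifferentiableAt (𝓡 n) 𝓘(ℝ, ℝ) φ x) :
    (differential φ x).comp (chartFrame e x) = fderiv ℝ (φ ∘ e.symm) (e x) := by
  have : IsManifold (𝓡 n) 1 M := IsManifold.of_le (n := ∞) (by norm_num)
  have h1 : MDifferentiableAt (𝓡 n) (𝓡 n) e.symm (e x) :=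
    (mdifferentiable_of_mem_atlas (I := 𝓡 n) he).symm.mdifferentiableAt (e.map_source hx)
  have h2 : HasMFDerivAt (𝓡 n) 𝓘(ℝ, ℝ) φ (e.symm (e x)) (differential φ x) := by
    have h := hφ.hasMFDerivAt
    have h3 : ∀ x', x' = x → HasMFDerivAt (𝓡 n) 𝓘(ℝ, ℝ) φ x' (differential φ x) := by
      rintro _ rfl; exact h
    exact h3 _ (e.left_inv hx)
  have h3 : HasMFDerivAt 𝓘(ℝ, EuclideanSpace ℝ (Fin n)) 𝓘(ℝ, ℝ) (φ ∘ e.symm) (e x)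
      ((differential φ x).comp (chartFrame e x)) := h2.comp (e x) h1.hasMFDerivAt
  have h4 : HasFDerivAt (φ ∘ e.symm)
      ((differential φ x).comp (chartFrame e x) : EuclideanSpace ℝ (Fin n) →L[ℝ] ℝ) (e x) :=
    hasMFDerivAt_iff_hasFDerivAt.1 h3
  exact h4.fderiv.symm

theorem continuousOn_fderiv_comp_symm {φ : M → ℝ} (hU : IsOpen U)
    (he : e ∈ atlas (EuclideanSpace ℝ (Fin n)) M)
    (hφ : ContMDiffOn (𝓡 n) 𝓘(ℝ, ℝ) 1 φ U) :
    ContinuousOn (fun x => fderiv ℝ (φ ∘ e.symm) (e x)) (e.source ∩ U) := by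
  have : IsManifold (𝓡 n) 1 M := IsManifold.of_le (n := ∞) (by norm_num)
  have h1 : ContMDiffOn (𝓡 n) (𝓡 n) 1 e.symm e.target :=
    contMDiffOn_symm_of_mem_maximalAtlas (IsManifold.subset_maximalAtlas he)
  have h2 : ContMDiffOn (𝓡 n) 𝓘(ℝ, ℝ) 1 (φ ∘ e.symm) (e.target ∩ e.symm ⁻¹' U) :=
    hφ.comp (h1.mono inter_subset_left) fun z hz => hz.2
  have h3 := (contMDiffOn_iff_contDiffOn.1 h2).continuousOn_fderiv_of_isOpen
    (e.symm.isOpen_inter_preimage hU) le_rfl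
  refine h3.comp (e.continuousOn.mono inter_subset_left) fun x hx => ⟨e.map_source hx.1, ?_⟩
  simpa [e.left_inv hx.1] using hx.2

theorem isMeasurableCovectorField_differential {φ : M → ℝ} (hU : IsOpen U)
    (hφ : ContMDiffOn (𝓡 n) 𝓘(ℝ, ℝ) 1 φ U) :
    IsMeasurableCovectorField (n := n) 𝔪 U (differential φ) := by
  intro e he v
  have h1 : AEMeasurable (fun x => fderiv ℝ (φ ∘ e.symm) (e x) v) (𝔪.restrict (e.source ∩ U)) :=
    ((continuousOn_fderiv_comp_symm hU he hφ).clm_apply continuousOn_const).aemeasurable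
      (e.open_source.inter hU).measurableSet
  refine h1.congr ((ae_restrict_mem (e.open_source.inter hU).measurableSet).mono
    fun x (hx : x ∈ e.source ∩ U) => ?_)
  have hd := (hφ.contMDiffAt (hU.mem_nhds hx.2)).mdifferentiableAt (n := 1) one_ne_zero
  exact (DFunLike.congr_fun (differential_comp_chartFrame he hx.1 hd) v).symm

theorem IsFinslerMetric.dualMetric_differential_eq_chart (hF : IsFinslerMetric F)
    {φ : M → ℝ} {x : M} (he : e ∈ atlas (EuclideanSpace ℝ (Fin n)) M) (hx : x ∈ e.source)
    (hφ : MDifferentiableAt (𝓡 n) 𝓘(ℝ, ℝ) φ x) :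
    dualMetric F x (differential (n := n) φ x) = chartMetric F e (e x)
      (chartGrad F e (e x) (fderiv ℝ (φ ∘ e.symm) (e x))) := by
  rw [← differential_comp_chartFrame he hx hφ]
  exact hF.dualMetric_eq_chart he hx _

theorem IsFinslerMetric.continuousOn_dualMetric_differential_chart (hF : IsFinslerMetric F)
    {φ : M → ℝ} (hU : IsOpen U) (hφ : ContMDiffOn (𝓡 n) 𝓘(ℝ, ℝ) 1 φ U)
    (he : e ∈ atlas (EuclideanSpace ℝ (Fin n)) M) :
    ContinuousOn (fun x => chartMetric F e (e x)
      (chartGrad F e (e x) (fderiv ℝ (φ ∘ e.symm) (e x)))) (e.source ∩ U) := by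
  have hce : ContinuousOn e (e.source ∩ U) := e.continuousOn.mono inter_subset_left
  have h1 : ContinuousOn (fun x => chartGrad F e (e x) (fderiv ℝ (φ ∘ e.symm) (e x)))
      (e.source ∩ U) :=
    ContinuousOn.comp (t := e.target ×ˢ univ)
      (f := fun x => (e x, fderiv ℝ (φ ∘ e.symm) (e x)))
      (hF.continuousOn_chartGrad he)
      (hce.prodMk (continuousOn_fderiv_comp_symm hU he hφ))
      fun x' hx' => ⟨e.map_source hx'.1, mem_univ _⟩
  exact ContinuousOn.comp (t := e.target ×ˢ univ)
    (f := fun x => (e x, chartGrad F e (e x) (fderiv ℝ (φ ∘ e.symm) (e x))))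
    (continuousOn_chartMetric hF.continuous he) (hce.prodMk h1)
    fun x' hx' => ⟨e.map_source hx'.1, mem_univ _⟩

theorem IsFinslerMetric.continuousOn_dualMetric_differential (hF : IsFinslerMetric F)
    {φ : M → ℝ} (hU : IsOpen U) (hφ : ContMDiffOn (𝓡 n) 𝓘(ℝ, ℝ) 1 φ U) :
    ContinuousOn (fun x => dualMetric F x (differential (n := n) φ x)) U := by
  refine continuousOn_of_locally_continuousOn fun x hx =>
    ⟨(chartAt (EuclideanSpace ℝ (Fin n)) x).source, (chartAt _ x).open_source,
      mem_chart_source _ x, ?_⟩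
  rw [inter_comm]
  refine (hF.continuousOn_dualMetric_differential_chart hU hφ (chart_mem_atlas _ x)).congr ?_
  intro x' hx'
  exact hF.dualMetric_differential_eq_chart (chart_mem_atlas _ x) hx'.1
    ((hφ.contMDiffAt (hU.mem_nhds hx'.2)).mdifferentiableAt (n := 1) one_ne_zero)

/-- In a chart near a point the metric is comparable to the Euclidean norm, which is symmetric, so
the ratio of the two constants works there. Compactness does the rest. -/
theorem IsFinslerMetric.exists_reversibility_bound (hF : IsFinslerMetric F) {K : Set M}
    (hK : IsCompact K) :
    ∃ C : ℝ, 0 ≤ C ∧ ∀ x ∈ K, ∀ y : TangentSpace (𝓡 n) x, F ⟨x, -y⟩ ≤ C * F ⟨x, y⟩ := by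
  refine hK.induction_on (p := fun K : Set M => ∃ C : ℝ, 0 ≤ C ∧ ∀ x ∈ K,
    ∀ y : TangentSpace (𝓡 n) x, F ⟨x, -y⟩ ≤ C * F ⟨x, y⟩) ?_ ?_ ?_ ?_
  · exact ⟨0, le_rfl, by simp⟩
  · rintro s t hst ⟨C, hC, h⟩
    exact ⟨C, hC, fun x hx => h x (hst hx)⟩
  · rintro s t ⟨C, hC, h⟩ ⟨D, hD, h'⟩
    refine ⟨max C D, le_max_of_le_left hC, ?_⟩
    rintro x (hx | hx) y
    · exact (h x hx y).trans (mul_le_mul_of_nonneg_right (le_max_left _ _) (hF.nonneg _))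
    · exact (h' x hx y).trans (mul_le_mul_of_nonneg_right (le_max_right _ _) (hF.nonneg _))
  · intro x hx
    set e := chartAt (EuclideanSpace ℝ (Fin n)) x
    have he : e ∈ atlas (EuclideanSpace ℝ (Fin n)) M := chart_mem_atlas _ x
    have hxe : x ∈ e.source := mem_chart_source _ x
    obtain ⟨V, hV, -, m, hm, C, hC, hb⟩ := exists_nhds_bounds e.open_target
      (continuousOn_chartMetric hF.continuous he) (hF.chartMetric_pos he) hF.chartMetric_smul
      (e.map_source hxe)
    refine ⟨e.source ∩ e ⁻¹' V, mem_nhdsWithin_of_mem_nhds (inter_mem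
      (e.open_source.mem_nhds hxe) ((e.continuousAt hxe).preimage_mem_nhds hV)), C / m,
      by positivity, ?_⟩
    rintro x' ⟨hx'e, hx'V⟩ y
    obtain ⟨w, rfl⟩ := chartFrame_surjective he hx'e y
    rw [← map_neg, ← chartMetric_apply (F := F) hx'e, ← chartMetric_apply (F := F) hx'e]
    have h1 := (hb _ hx'V (-w)).2
    have h2 := (hb _ hx'V w).1
    rw [norm_neg] at h1
    calc chartMetric F e (e x') (-w) ≤ C * ‖w‖ := h1
      _ = C / m * (m * ‖w‖) := by field_simp
      _ ≤ _ := by gcongr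

end

/-! ### Local finiteness of smooth measures -/

theorem IsSmoothMeasure.isLocallyFiniteMeasure {n : ℕ} {M : Type*} [TopologicalSpace M]
    [ChartedSpace (EuclideanSpace ℝ (Fin n)) M] [MeasurableSpace M] [BorelSpace M]
    {𝔪 : Measure M} (h𝔪 : IsSmoothMeasure n 𝔪) : IsLocallyFiniteMeasure 𝔪 := by
  refine ⟨fun x => ?_⟩
  set e := chartAt (EuclideanSpace ℝ (Fin n)) x
  have hxe : x ∈ e.source := mem_chart_source _ x
  obtain ⟨σ, hσ, -, hmap⟩ := h𝔪 e (chart_mem_atlas _ x)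
  obtain ⟨K, hK, hKT, hKc⟩ := local_compact_nhds (e.open_target.mem_nhds (e.map_source hxe))
  obtain ⟨C, hC⟩ := hKc.exists_bound_of_continuousOn (hσ.continuousOn.mono hKT)
  refine ⟨e.source ∩ e ⁻¹' K, inter_mem (e.open_source.mem_nhds hxe)
    ((e.continuousAt hxe).preimage_mem_nhds hK), ?_⟩
  have hem : AEMeasurable e (𝔪.restrict e.source) :=
    e.continuousOn.aemeasurable e.open_source.measurableSet
  have h1 : ((𝔪.restrict e.source).map e) K = 𝔪 (e.source ∩ e ⁻¹' K) := by
    rw [Measure.map_apply_of_aemeasurable hem hKc.measurableSet,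
      Measure.restrict_apply₀' e.open_source.measurableSet.nullMeasurableSet, inter_comm]
  rw [← h1, hmap, withDensity_apply _ hKc.measurableSet,
    Measure.restrict_restrict hKc.measurableSet, inter_eq_left.2 hKT]
  calc ∫⁻ z in K, ENNReal.ofReal (σ z) ≤ ∫⁻ _ in K, ENNReal.ofReal C :=
        setLIntegral_mono measurable_const fun z hz =>
          ENNReal.ofReal_le_ofReal ((le_abs_self _).trans (hC z hz))
    _ = ENNReal.ofReal C * volume K := setLIntegral_const _ _
    _ < ⊤ := ENNReal.mul_lt_top ENNReal.ofReal_lt_top hKc.measure_lt_top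

end

section

/-! ### Limits of integrals -/

section Limits

variable {X : Type*} [MeasurableSpace X] {μ : Measure X} {p : ℝ}

theorem mul_rpow_sub_one_le {a b p : ℝ} (ha : 0 ≤ a) (hb : 0 ≤ b) (hp : 1 < p) :
    b ^ (p - 1) * a ≤ a ^ p + b ^ p := by
  have h : ∀ c : ℝ, 0 ≤ c → c ^ (p - 1) * c = c ^ p := fun c hc => by
    rcases hc.eq_or_lt with rfl | hc
    · rw [mul_zero, Real.zero_rpow (by linarith)]
    · rw [Real.rpow_sub_one hc.ne', div_mul_cancel₀ _ hc.ne']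
  have hpa : 0 ≤ a ^ p := by positivity
  have hpb : 0 ≤ b ^ p := by positivity
  rcases le_total a b with hab | hab
  · calc b ^ (p - 1) * a ≤ b ^ (p - 1) * b := by gcongr
      _ = b ^ p := h b hb
      _ ≤ _ := by linarith
  · calc b ^ (p - 1) * a ≤ a ^ (p - 1) * a := by gcongr
      _ = a ^ p := h a ha
      _ ≤ _ := by linarith

/-- Hölder's inequality with the conjugate exponent `q`, for which `(p - 1) * q = p`. -/
theorem tendsto_lintegral_rpow_sub_one_mul (hp : 1 < p) {N : X → ℝ} (hN : ∀ x, 0 ≤ N x)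
    (hNm : AEMeasurable N μ) (hNp : Integrable (fun x => N x ^ p) μ) {D : ℕ → X → ℝ}
    (hD : ∀ j x, 0 ≤ D j x) (hDm : ∀ j, AEMeasurable (D j) μ)
    (hDp : Tendsto (fun j => ∫⁻ x, ENNReal.ofReal (D j x ^ p) ∂μ) atTop (𝓝 0)) :
    Tendsto (fun j => ∫⁻ x, ENNReal.ofReal (N x ^ (p - 1) * D j x) ∂μ) atTop (𝓝 0) := by
  have hp0 : 0 < p := by linarith
  have hpq := Real.HolderConjugate.conjExponent hp
  set q := Real.conjExponent p
  have hb : ∀ j, ∫⁻ x, ENNReal.ofReal (N x ^ (p - 1) * D j x) ∂μ ≤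
      (∫⁻ x, ENNReal.ofReal (D j x ^ p) ∂μ) ^ (1 / p) *
        (∫⁻ x, ENNReal.ofReal (N x ^ p) ∂μ) ^ (1 / q) := by
    intro j
    have h := ENNReal.lintegral_mul_le_Lp_mul_Lq μ hpq
      (f := fun x => ENNReal.ofReal (D j x)) (g := fun x => ENNReal.ofReal (N x ^ (p - 1)))
      (hDm j).ennreal_ofReal (hNm.pow_const _).ennreal_ofReal
    convert h using 3 with x
    · rw [Pi.mul_apply, mul_comm, ENNReal.ofReal_mul (hD j x)]
    · refine lintegral_congr fun x => ?_
      rw [ENNReal.ofReal_rpow_of_nonneg (hD j x) hp0.le]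
    · refine lintegral_congr fun x => ?_
      rw [ENNReal.ofReal_rpow_of_nonneg (Real.rpow_nonneg (hN x) _) hpq.symm.nonneg,
        ← Real.rpow_mul (hN x), hpq.sub_one_mul_conj]
  have hfin : (∫⁻ x, ENNReal.ofReal (N x ^ p) ∂μ) ^ (1 / q) ≠ ⊤ :=
    ENNReal.rpow_ne_top_of_nonneg (one_div_nonneg.2 hpq.symm.nonneg)
      hNp.lintegral_lt_top.ne
  have hlim : Tendsto (fun j => (∫⁻ x, ENNReal.ofReal (D j x ^ p) ∂μ) ^ (1 / p) *
      (∫⁻ x, ENNReal.ofReal (N x ^ p) ∂μ) ^ (1 / q)) atTop (𝓝 0) := by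
    have h1 := ((ENNReal.continuous_rpow_const (y := 1 / p)).tendsto 0).comp hDp
    rw [ENNReal.zero_rpow_of_pos (by positivity)] at h1
    have h2 := ENNReal.Tendsto.mul_const h1 (Or.inr hfin)
    rwa [zero_mul] at h2
  exact tendsto_of_tendsto_of_tendsto_of_le_of_le tendsto_const_nhds hlim (fun _ => zero_le)
    hb

theorem exists_subseq_tendsto_ae (hp : 1 < p) {ρ : X → ℝ} (hρ : AEMeasurable ρ μ)
    {φ : ℕ → X → ℝ} (hφ : ∀ j, AEMeasurable (φ j) μ)
    (h : Tendsto (fun j => ∫⁻ x, ENNReal.ofReal (|φ j x - ρ x| ^ p) ∂μ) atTop (𝓝 0)) :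
    ∃ ns : ℕ → ℕ, StrictMono ns ∧
      ∀ᵐ x ∂μ, Tendsto (fun j => φ (ns j) x) atTop (𝓝 (ρ x)) := by
  have hp0 : 0 < p := by linarith
  refine TendstoInMeasure.exists_seq_tendsto_ae (tendstoInMeasure_of_tendsto_eLpNorm
    (p := ENNReal.ofReal p) (by simpa using hp0) (fun j => (hφ j).aestronglyMeasurable)
    hρ.aestronglyMeasurable ?_)
  have h1 := ((ENNReal.continuous_rpow_const (y := 1 / p)).tendsto 0).comp h
  rw [ENNReal.zero_rpow_of_pos (by positivity)] at h1
  refine h1.congr fun j => ?_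
  rw [eLpNorm_eq_lintegral_rpow_enorm_toReal (by simpa using hp0) ENNReal.ofReal_ne_top,
    ENNReal.toReal_ofReal hp0.le]
  simp only [Function.comp_def, Pi.sub_apply]
  congr 2
  ext x
  rw [← ENNReal.ofReal_rpow_of_nonneg (abs_nonneg _) hp0.le, Real.enorm_eq_ofReal_abs]

variable [IsFiniteMeasure μ] {ρ N a w : X → ℝ} {ψ ψ' : ℝ → ℝ} {A B L : ℝ}

theorem abs_le_of_hasDerivAt (hψ : ∀ t, HasDerivAt ψ (ψ' t) t) (hL : ∀ t, |ψ' t| ≤ L) (s t : ℝ) :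
    |ψ s - ψ t| ≤ L * |s - t| := by
  have := convex_univ.norm_image_sub_le_of_norm_hasDerivWithin_le (C := L) (f := ψ) (f' := ψ')
    (fun x _ => (hψ x).hasDerivWithinAt) (fun x _ => hL x) (mem_univ t) (mem_univ s)
  simpa using this

/-- The function `ψ` grows at most linearly, so after Young's inequality the product is dominated by
constants, `|ρ|^p` and `N^p`. -/
theorem integrable_comp_mul (hp : 1 < p) (hρ : AEMeasurable ρ μ)
    (hρp : Integrable (fun x => |ρ x| ^ p) μ) (hN : ∀ x, 0 ≤ N x)
    (hNp : Integrable (fun x => N x ^ p) μ)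
    (hψ : ∀ t, HasDerivAt ψ (ψ' t) t) (hL : ∀ t, |ψ' t| ≤ L)
    (ha : AEMeasurable a μ) (haA : ∀ᵐ x ∂μ, |a x| ≤ A * N x ^ (p - 1)) :
    Integrable (fun x => ψ (ρ x) * a x) μ := by
  have hψc : Continuous ψ := continuous_iff_continuousAt.2 fun t => (hψ t).continuousAt
  have hL0 : 0 ≤ L := (abs_nonneg _).trans (hL 0)
  have hbound : Integrable
      (fun x => |ψ 0| * |A| * (1 + N x ^ p) + L * |A| * (|ρ x| ^ p + N x ^ p)) μ :=
    (((integrable_const 1).add hNp).const_mul _).add ((hρp.add hNp).const_mul _)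
  refine hbound.mono' ((hψc.measurable.comp_aemeasurable hρ).mul ha).aestronglyMeasurable ?_
  filter_upwards [haA] with x hx
  have h1 : |a x| ≤ |A| * N x ^ (p - 1) :=
    hx.trans (mul_le_mul_of_nonneg_right (le_abs_self A) (Real.rpow_nonneg (hN x) _))
  have h2 : |ψ (ρ x)| ≤ |ψ 0| + L * |ρ x| := by
    have := abs_le_of_hasDerivAt hψ hL (ρ x) 0
    rw [sub_zero] at this
    have h3 := abs_sub_abs_le_abs_sub (ψ (ρ x)) (ψ 0)
    linarith
  have h3 := mul_rpow_sub_one_le (abs_nonneg (ρ x)) (hN x) hp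
  have h4 := mul_rpow_sub_one_le zero_le_one (hN x) hp
  rw [Real.one_rpow, mul_one] at h4
  rw [Real.norm_eq_abs, abs_mul]
  calc |ψ (ρ x)| * |a x| ≤ (|ψ 0| + L * |ρ x|) * (|A| * N x ^ (p - 1)) := by gcongr
    _ = |ψ 0| * |A| * N x ^ (p - 1) + L * |A| * (N x ^ (p - 1) * |ρ x|) := by ring
    _ ≤ _ := by gcongr

theorem integrable_mul_comp_mul (hρ : AEMeasurable ρ μ)
    (hNp : Integrable (fun x => N x ^ p) μ)
    (hψ' : Continuous ψ') (hL : ∀ t, |ψ' t| ≤ L)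
    (hw : AEMeasurable w μ) (hwB : ∀ x, |w x| ≤ B) :
    Integrable (fun x => w x * ψ' (ρ x) * N x ^ p) μ := by
  refine hNp.bdd_mul (c := B * L)
    (hw.mul (hψ'.measurable.comp_aemeasurable hρ)).aestronglyMeasurable
    (Eventually.of_forall fun x => ?_)
  rw [Real.norm_eq_abs, abs_mul]
  have hB : 0 ≤ B := (abs_nonneg _).trans (hwB x)
  exact mul_le_mul (hwB x) (hL _) (abs_nonneg _) hB

/-- The measure-theoretic core of replacing `φ_j` by `ρ`. Here `N` stands for `F(∇ρ)`, `T j` for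
`F^(p-2)(∇ρ) dφ_j(∇ρ)`, and `D j` for a multiple of `F*(dφ_j - dρ)`. The difference of the
integrands has three parts. Those with `ψ(φ_j) - ψ(ρ)` and `T j - N^p` tend to zero by Hölder's
inequality. The part with `ψ'(φ_j) - ψ'(ρ)` is treated by dominated convergence, and it alone
requires almost everywhere convergence, hence a subsequence. -/
theorem exists_subseq_tendsto_integral (hp : 1 < p) (hρ : AEMeasurable ρ μ)
    (hρp : Integrable (fun x => |ρ x| ^ p) μ) (hN : ∀ x, 0 ≤ N x) (hNm : AEMeasurable N μ)
    (hNp : Integrable (fun x => N x ^ p) μ)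
    (hψ : ∀ t, HasDerivAt ψ (ψ' t) t) (hψ' : Continuous ψ') (hL : ∀ t, |ψ' t| ≤ L)
    (ha : AEMeasurable a μ) (hA : 0 ≤ A) (haA : ∀ᵐ x ∂μ, |a x| ≤ A * N x ^ (p - 1))
    (hw : AEMeasurable w μ) (hB : 0 ≤ B) (hwB : ∀ x, |w x| ≤ B)
    {φ : ℕ → X → ℝ} (hφ : ∀ j, AEMeasurable (φ j) μ)
    (hφρ : Tendsto (fun j => ∫⁻ x, ENNReal.ofReal (|φ j x - ρ x| ^ p) ∂μ) atTop (𝓝 0))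
    {T D : ℕ → X → ℝ} (hT : ∀ j, AEMeasurable (T j) μ) (hD : ∀ j x, 0 ≤ D j x)
    (hDm : ∀ j, AEMeasurable (D j) μ)
    (hDp : Tendsto (fun j => ∫⁻ x, ENNReal.ofReal (D j x ^ p) ∂μ) atTop (𝓝 0))
    (hTD : ∀ j, ∀ᵐ x ∂μ, |T j x - N x ^ p| ≤ N x ^ (p - 1) * D j x) :
    ∃ ns : ℕ → ℕ, Tendsto
      (fun j => ∫ x, ψ (φ (ns j) x) * a x + w x * ψ' (φ (ns j) x) * T (ns j) x ∂μ) atTop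
      (𝓝 (∫ x, ψ (ρ x) * a x + w x * ψ' (ρ x) * N x ^ p ∂μ)) := by
  obtain ⟨ns, hns, hae⟩ := exists_subseq_tendsto_ae hp hρ hφ hφρ
  refine ⟨ns, ?_⟩
  have hψc : Continuous ψ := continuous_iff_continuousAt.2 fun t => (hψ t).continuousAt
  have hL0 : 0 ≤ L := (abs_nonneg _).trans (hL 0)
  have hG : Integrable (fun x => ψ (ρ x) * a x + w x * ψ' (ρ x) * N x ^ p) μ :=
    (integrable_comp_mul hp hρ hρp hN hNp hψ hL ha haA).add
      (integrable_mul_comp_mul hρ hNp hψ' hL hw hwB)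
  have e1 := (tendsto_lintegral_rpow_sub_one_mul hp hN hNm hNp
    (D := fun j x => |φ j x - ρ x|) (fun _ _ => abs_nonneg _)
    (fun j => ((hφ j).sub hρ).norm) hφρ).comp hns.tendsto_atTop
  have e2 := (tendsto_lintegral_rpow_sub_one_mul hp hN hNm hNp hD hDm hDp).comp
    hns.tendsto_atTop
  have e3 : Tendsto (fun j => ∫⁻ x, ENNReal.ofReal (|ψ' (φ (ns j) x) - ψ' (ρ x)| * N x ^ p) ∂μ)
      atTop (𝓝 0) := by
    have h := tendsto_lintegral_of_dominated_convergence' (μ := μ)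
      (F := fun j x => ENNReal.ofReal (|ψ' (φ (ns j) x) - ψ' (ρ x)| * N x ^ p))
      (f := fun _ => 0) (fun x => ENNReal.ofReal (2 * L * N x ^ p))
      (fun j => (((hψ'.measurable.comp_aemeasurable (hφ _)).sub
        (hψ'.measurable.comp_aemeasurable hρ)).norm.mul (hNm.pow_const _)).ennreal_ofReal)
      (fun j => Eventually.of_forall fun x => ENNReal.ofReal_le_ofReal ?_)
      (hNp.const_mul _).lintegral_lt_top.ne ?_
    · simpa using h
    · refine mul_le_mul_of_nonneg_right ?_ (Real.rpow_nonneg (hN x) _)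
      have := abs_sub (ψ' (φ (ns j) x)) (ψ' (ρ x))
      linarith [hL (φ (ns j) x), hL (ρ x)]
    · filter_upwards [hae] with x hx
      have h1 : Tendsto (fun j => |ψ' (φ (ns j) x) - ψ' (ρ x)| * N x ^ p) atTop
          (𝓝 (|ψ' (ρ x) - ψ' (ρ x)| * N x ^ p)) :=
        (((hψ'.tendsto _).comp hx).sub_const _).abs.mul_const _
      rw [sub_self, abs_zero, zero_mul] at h1
      rw [← ENNReal.ofReal_zero]
      exact (ENNReal.continuous_ofReal.tendsto 0).comp h1
  have hGm : ∀ j, AEMeasurable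
      (fun x => ψ (φ (ns j) x) * a x + w x * ψ' (φ (ns j) x) * T (ns j) x) μ := fun j =>
    ((hψc.measurable.comp_aemeasurable (hφ _)).mul ha).add
      ((hw.mul (hψ'.measurable.comp_aemeasurable (hφ _))).mul (hT _))
  have hlim : Tendsto (fun j => ∫⁻ x, ‖(ψ (φ (ns j) x) * a x + w x * ψ' (φ (ns j) x) * T (ns j) x)
      - (ψ (ρ x) * a x + w x * ψ' (ρ x) * N x ^ p)‖ₑ ∂μ) atTop (𝓝 0) := by
    have hsum := ((ENNReal.Tendsto.const_mul e1 (Or.inr (ENNReal.ofReal_ne_top (r := L * A)))).add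
      (ENNReal.Tendsto.const_mul e2 (Or.inr (ENNReal.ofReal_ne_top (r := B * L))))).add
      (ENNReal.Tendsto.const_mul e3 (Or.inr (ENNReal.ofReal_ne_top (r := B))))
    simp only [mul_zero, add_zero] at hsum
    refine tendsto_of_tendsto_of_tendsto_of_le_of_le tendsto_const_nhds hsum
      (fun _ => zero_le) fun j => ?_
    have m1 : AEMeasurable (fun x => ENNReal.ofReal (N x ^ (p - 1) * |φ (ns j) x - ρ x|)) μ :=
      ((hNm.pow_const _).mul ((hφ _).sub hρ).norm).ennreal_ofReal
    have m2 : AEMeasurable (fun x => ENNReal.ofReal (N x ^ (p - 1) * D (ns j) x)) μ :=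
      ((hNm.pow_const _).mul (hDm _)).ennreal_ofReal
    simp only [Function.comp_def]
    rw [← lintegral_const_mul' _ _ ENNReal.ofReal_ne_top,
      ← lintegral_const_mul' _ _ ENNReal.ofReal_ne_top,
      ← lintegral_const_mul' _ _ ENNReal.ofReal_ne_top,
      ← lintegral_add_left' (m1.const_mul _),
      ← lintegral_add_left' (f := fun x => ENNReal.ofReal (L * A) *
        ENNReal.ofReal (N x ^ (p - 1) * |φ (ns j) x - ρ x|) + ENNReal.ofReal (B * L) *
        ENNReal.ofReal (N x ^ (p - 1) * D (ns j) x)) ((m1.const_mul _).add (m2.const_mul _))]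
    refine lintegral_mono_ae ?_
    filter_upwards [haA, hTD (ns j)] with x hx1 hx2
    have hN1 : 0 ≤ N x ^ (p - 1) := Real.rpow_nonneg (hN x) _
    have hNp0 : 0 ≤ N x ^ p := Real.rpow_nonneg (hN x) _
    rw [← ENNReal.ofReal_mul (by positivity), ← ENNReal.ofReal_mul (by positivity),
      ← ENNReal.ofReal_mul hB, ← ENNReal.ofReal_add (by positivity)
        (mul_nonneg (by positivity) (mul_nonneg hN1 (hD _ _))),
      ← ENNReal.ofReal_add (add_nonneg (by positivity)
        (mul_nonneg (by positivity) (mul_nonneg hN1 (hD _ _)))) (by positivity),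
      Real.enorm_eq_ofReal_abs]
    refine ENNReal.ofReal_le_ofReal ?_
    have h1 := abs_le_of_hasDerivAt hψ hL (φ (ns j) x) (ρ x)
    have hsplit : ψ (φ (ns j) x) * a x + w x * ψ' (φ (ns j) x) * T (ns j) x -
        (ψ (ρ x) * a x + w x * ψ' (ρ x) * N x ^ p) =
        (ψ (φ (ns j) x) - ψ (ρ x)) * a x + w x * ψ' (φ (ns j) x) * (T (ns j) x - N x ^ p) +
        w x * ((ψ' (φ (ns j) x) - ψ' (ρ x)) * N x ^ p) := by ring
    rw [hsplit]
    refine (abs_add_le _ _).trans (add_le_add ((abs_add_le _ _).trans (add_le_add ?_ ?_)) ?_)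
    · rw [abs_mul]
      calc _ ≤ L * |φ (ns j) x - ρ x| * (A * N x ^ (p - 1)) := by gcongr
        _ = _ := by ring
    · rw [abs_mul, abs_mul]
      exact mul_le_mul (mul_le_mul (hwB x) (hL _) (abs_nonneg _) hB) hx2 (abs_nonneg _)
        (by positivity)
    · rw [abs_mul, abs_mul, abs_of_nonneg hNp0]
      exact mul_le_mul_of_nonneg_right (hwB x) (by positivity)
  refine tendsto_integral_of_L1 _ hG.aestronglyMeasurable ?_ hlim
  -- The approximating integrands are integrable, for large `j`, as the limit plus a difference of
  -- finite `L¹` norm.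
  filter_upwards [hlim.eventually_lt_const ENNReal.zero_lt_top] with j hj
  have h1 : Integrable (fun x =>
      (ψ (φ (ns j) x) * a x + w x * ψ' (φ (ns j) x) * T (ns j) x) -
        (ψ (ρ x) * a x + w x * ψ' (ρ x) * N x ^ p)) μ :=
    ⟨(hGm j).aestronglyMeasurable.sub hG.aestronglyMeasurable, hj⟩
  have h2 := h1.add hG
  refine h2.congr (Eventually.of_forall fun x => ?_)
  simp

end Limits

end

section

/-! ### Absorption by Hölder's inequality -/

/-- Cancel `I^(1/q)`, which is legitimate because `I` is finite and may be taken nonzero, then raise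
to the power `p`. -/
theorem ENNReal_le_of_le_mul_rpow {p q : ℝ} (hpq : p.HolderConjugate q) {I J C : ℝ≥0∞}
    (hI : I ≠ ⊤) (h : I ≤ C * (J ^ (1 / p) * I ^ (1 / q))) : I ≤ C ^ p * J := by
  rcases eq_or_ne I 0 with rfl | hI0
  · exact zero_le
  have hp := hpq.pos
  have hsplit : I = I ^ (1 / p) * I ^ (1 / q) := by
    rw [← ENNReal.rpow_add _ _ hI0 hI, one_div, one_div, hpq.inv_add_inv_eq_one, ENNReal.rpow_one]
  have h0 : I ^ (1 / q) ≠ 0 := (ENNReal.rpow_pos (pos_iff_ne_zero.2 hI0) hI).ne'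
  have ht : I ^ (1 / q) ≠ ⊤ := ENNReal.rpow_ne_top_of_nonneg (one_div_nonneg.2 hpq.symm.nonneg) hI
  have h1 : I ^ (1 / p) * I ^ (1 / q) ≤ C * J ^ (1 / p) * I ^ (1 / q) := by
    rw [← hsplit, mul_assoc]; exact h
  have h2 := (ENNReal.mul_le_mul_iff_left h0 ht).1 h1
  calc I = (I ^ (1 / p)) ^ p := by
        rw [← ENNReal.rpow_mul, one_div, inv_mul_cancel₀ hp.ne', ENNReal.rpow_one]
    _ ≤ (C * J ^ (1 / p)) ^ p := ENNReal.rpow_le_rpow h2 hp.le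
    _ = C ^ p * J := by
        rw [ENNReal.mul_rpow_of_nonneg _ _ hp.le, ← ENNReal.rpow_mul, one_div,
          inv_mul_cancel₀ hp.ne', ENNReal.rpow_one]

section Absorption

variable {X : Type*} [MeasurableSpace X] {μ : Measure X} [IsFiniteMeasure μ] {p c A B L : ℝ}
  {ρ N a u m : X → ℝ} {ψ ψ' : ℝ → ℝ}

/-- The sign condition `c * ψ' < 0` turns the weak inequality into an upper bound of the gradient
term by the term containing `du`. Boundedness of `ψ'` and of `u` makes that gradient term finite, so
it can be absorbed after Hölder's inequality. -/
theorem lintegral_le_of_weak (hp : 1 < p) (hc : c ≠ 0) (hρ : AEMeasurable ρ μ)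
    (hρp : Integrable (fun x => |ρ x| ^ p) μ) (hN : ∀ x, 0 ≤ N x) (hNm : AEMeasurable N μ)
    (hNp : Integrable (fun x => N x ^ p) μ)
    (hψ : ∀ t, HasDerivAt ψ (ψ' t) t) (hψ' : Continuous ψ') (hL : ∀ t, |ψ' t| ≤ L)
    (hψpos : ∀ t, 0 < ψ t) (hψneg : ∀ t, c * ψ' t < 0)
    (ha : AEMeasurable a μ) (haA : ∀ᵐ x ∂μ, |a x| ≤ A * N x ^ (p - 1))
    (hu : AEMeasurable u μ) (huB : ∀ x, |u x| ^ p ≤ B)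
    (hm : AEMeasurable m μ) (hm0 : ∀ x, 0 ≤ m x)
    (ham : ∀ x, |a x| ≤ p * (|u x| ^ (p - 1) * (N x ^ (p - 1) * m x)))
    (hweak : 0 ≤ c * ∫ x, ψ (ρ x) * a x + |u x| ^ p * ψ' (ρ x) * N x ^ p ∂μ) :
    ∫⁻ x, ENNReal.ofReal (|u x| ^ p * |ψ' (ρ x)| * N x ^ p) ∂μ ≤
      ENNReal.ofReal p ^ p *
        ∫⁻ x, ENNReal.ofReal (ψ (ρ x) ^ p * |ψ' (ρ x)| ^ (1 - p) * m x ^ p) ∂μ := by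
  have hp0 : 0 < p := by linarith
  have hpq := Real.HolderConjugate.conjExponent hp
  set q := Real.conjExponent p
  have hq0 := hpq.symm.pos
  have hψc : Continuous ψ := continuous_iff_continuousAt.2 fun t => (hψ t).continuousAt
  have hψpm : AEMeasurable (fun x => |ψ' (ρ x)|) μ :=
    (hψ'.measurable.comp_aemeasurable hρ).norm
  have hψm : AEMeasurable (fun x => ψ (ρ x)) μ := hψc.measurable.comp_aemeasurable hρ
  have hψ'0 : ∀ t, 0 < |ψ' t| := fun t => abs_pos.2 fun h => by simpa [h] using hψneg t
  have i1 := integrable_comp_mul hp hρ hρp hN hNp hψ hL ha haA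
  have i2 : Integrable (fun x => |u x| ^ p * ψ' (ρ x) * N x ^ p) μ :=
    integrable_mul_comp_mul hρ hNp hψ' hL (hu.norm.pow_const p) (B := B) fun x =>
      (abs_of_nonneg (Real.rpow_nonneg (abs_nonneg (u x)) p)).le.trans (huB x)
  have habs : ∀ t, |c| * |ψ' t| = -c * ψ' t := fun t => by
    rw [← abs_mul, abs_of_neg (hψneg t)]; ring
  have hcp : 0 < |c| := abs_pos.2 hc
  have i3 : Integrable (fun x => |u x| ^ p * |ψ' (ρ x)| * N x ^ p) μ := by
    refine i2.abs.congr (Eventually.of_forall fun x => ?_)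
    simp only [abs_mul]
    rw [abs_of_nonneg (Real.rpow_nonneg (abs_nonneg (u x)) p),
      abs_of_nonneg (Real.rpow_nonneg (hN x) p)]
  have i4 : Integrable (fun x => ψ (ρ x) * |a x|) μ := by
    refine i1.abs.congr (Eventually.of_forall fun x => ?_)
    simp only [abs_mul]
    rw [abs_of_pos (hψpos _)]
  have hreal : ∫ x, |u x| ^ p * |ψ' (ρ x)| * N x ^ p ∂μ ≤ ∫ x, ψ (ρ x) * |a x| ∂μ := by
    rw [integral_add i1 i2] at hweak
    have e1 : |c| * ∫ x, |u x| ^ p * |ψ' (ρ x)| * N x ^ p ∂μ =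
        -c * ∫ x, |u x| ^ p * ψ' (ρ x) * N x ^ p ∂μ := by
      rw [← integral_const_mul, ← integral_const_mul]
      refine integral_congr_ae (Eventually.of_forall fun x => ?_)
      calc |c| * (|u x| ^ p * |ψ' (ρ x)| * N x ^ p)
          = |u x| ^ p * (|c| * |ψ' (ρ x)|) * N x ^ p := by ring
        _ = _ := by rw [habs]; ring
    have e2 : c * ∫ x, ψ (ρ x) * a x ∂μ ≤ |c| * ∫ x, ψ (ρ x) * |a x| ∂μ := by
      rw [← integral_const_mul, ← integral_const_mul]
      refine integral_mono (i1.const_mul _) (i4.const_mul _) fun x => ?_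
      calc c * (ψ (ρ x) * a x) ≤ |c * (ψ (ρ x) * a x)| := le_abs_self _
        _ = _ := by rw [abs_mul, abs_mul, abs_of_pos (hψpos _)]
    refine le_of_mul_le_mul_left ?_ hcp
    linarith
  have hIeq : ENNReal.ofReal (∫ x, |u x| ^ p * |ψ' (ρ x)| * N x ^ p ∂μ) =
      ∫⁻ x, ENNReal.ofReal (|u x| ^ p * |ψ' (ρ x)| * N x ^ p) ∂μ :=
    ofReal_integral_eq_lintegral_ofReal i3 (Eventually.of_forall fun x =>
      mul_nonneg (mul_nonneg (Real.rpow_nonneg (abs_nonneg _) _) (abs_nonneg _))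
        (Real.rpow_nonneg (hN x) _))
  have hle : ∫⁻ x, ENNReal.ofReal (|u x| ^ p * |ψ' (ρ x)| * N x ^ p) ∂μ ≤
      ENNReal.ofReal p *
        ∫⁻ x, ENNReal.ofReal (ψ (ρ x) * (|u x| ^ (p - 1) * (N x ^ (p - 1) * m x))) ∂μ := by
    rw [← hIeq, ← lintegral_const_mul' _ _ ENNReal.ofReal_ne_top]
    refine (ENNReal.ofReal_le_ofReal hreal).trans ?_
    rw [ofReal_integral_eq_lintegral_ofReal i4 (Eventually.of_forall fun x =>
      mul_nonneg (hψpos _).le (abs_nonneg _))]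
    refine lintegral_mono fun x => ?_
    rw [← ENNReal.ofReal_mul hp0.le]
    refine ENNReal.ofReal_le_ofReal ?_
    calc ψ (ρ x) * |a x| ≤ ψ (ρ x) * (p * (|u x| ^ (p - 1) * (N x ^ (p - 1) * m x))) :=
          mul_le_mul_of_nonneg_left (ham x) (hψpos _).le
      _ = _ := by ring
  refine ENNReal_le_of_le_mul_rpow hpq (hIeq ▸ ENNReal.ofReal_ne_top) (hle.trans ?_)
  gcongr
  -- The weight `|ψ'|^((p-1)/p)` is inserted in one factor and divided out of the other, so that the
  -- `q`-th power of the second factor is exactly the integrand on the left.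
  have h := ENNReal.lintegral_mul_le_Lp_mul_Lq μ hpq
    (f := fun x => ENNReal.ofReal (ψ (ρ x) * |ψ' (ρ x)| ^ (-(p - 1) / p) * m x))
    (g := fun x => ENNReal.ofReal (|u x| ^ (p - 1) * |ψ' (ρ x)| ^ ((p - 1) / p) * N x ^ (p - 1)))
    ((hψm.mul (hψpm.pow_const _)).mul hm).ennreal_ofReal
    (((hu.norm.pow_const _).mul (hψpm.pow_const _)).mul (hNm.pow_const _)).ennreal_ofReal
  refine le_of_eq_of_le (lintegral_congr fun x => ?_) (h.trans_eq ?_)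
  · rw [Pi.mul_apply, ← ENNReal.ofReal_mul (mul_nonneg (mul_nonneg (hψpos _).le
      (Real.rpow_nonneg (abs_nonneg _) _)) (hm0 x))]
    congr 1
    have h1 : |ψ' (ρ x)| ^ (-(p - 1) / p) * |ψ' (ρ x)| ^ ((p - 1) / p) = 1 := by
      rw [← Real.rpow_add (hψ'0 _), neg_div, neg_add_cancel, Real.rpow_zero]
    calc _ = ψ (ρ x) * (|u x| ^ (p - 1) * (N x ^ (p - 1) * m x)) *
          (|ψ' (ρ x)| ^ (-(p - 1) / p) * |ψ' (ρ x)| ^ ((p - 1) / p)) := by rw [h1, mul_one]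
      _ = _ := by ring
  · have hpow : ∀ y : ℝ, 0 ≤ y → (y ^ (p - 1)) ^ q = y ^ p := fun y hy => by
      rw [← Real.rpow_mul hy, hpq.sub_one_mul_conj]
    congr 2
    · refine lintegral_congr fun x => ?_
      have h1 := hψpos (ρ x)
      have h2 := hm0 x
      rw [ENNReal.ofReal_rpow_of_nonneg (by positivity) hp0.le,
        Real.mul_rpow (by positivity) h2, Real.mul_rpow h1.le (by positivity),
        ← Real.rpow_mul (abs_nonneg _)]
      congr 4
      field_simp
      ring
    · refine lintegral_congr fun x => ?_
      have h2 := hN x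
      rw [ENNReal.ofReal_rpow_of_nonneg (by positivity) hq0.le,
        Real.mul_rpow (by positivity) (by positivity), Real.mul_rpow (by positivity)
        (by positivity), hpow _ (abs_nonneg _), hpow _ h2, ← Real.rpow_mul (abs_nonneg _),
        div_mul_eq_mul_div, hpq.sub_one_mul_conj, div_self hp0.ne', Real.rpow_one]

end Absorption

/-! ### A positive `C¹` modification of `t ↦ t + ε` on the negative half line -/

/-- The function `t ↦ t + ε` for `t ≥ 0`, continued by an exponential for `t < 0`. -/
def posShift (ε t : ℝ) : ℝ :=
  if 0 ≤ t then t + ε else ε / 2 + ε / 2 * Real.exp (2 * t / ε)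

/-- The derivative of `posShift`. -/
def posShiftDeriv (ε t : ℝ) : ℝ := Real.exp (min 0 (2 * t / ε))

variable {ε : ℝ}

theorem posShift_of_nonneg {t : ℝ} (ht : 0 ≤ t) : posShift ε t = t + ε := if_pos ht

theorem posShiftDeriv_of_nonneg (hε : 0 < ε) {t : ℝ} (ht : 0 ≤ t) : posShiftDeriv ε t = 1 := by
  rw [posShiftDeriv, min_eq_left (by positivity), Real.exp_zero]

theorem posShiftDeriv_pos (t : ℝ) : 0 < posShiftDeriv ε t := Real.exp_pos _

theorem posShiftDeriv_le_one (t : ℝ) : posShiftDeriv ε t ≤ 1 :=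
  Real.exp_le_one_iff.2 (min_le_left _ _)

theorem continuous_posShiftDeriv : Continuous (posShiftDeriv ε) := by
  unfold posShiftDeriv; fun_prop

theorem half_le_posShift (hε : 0 < ε) (t : ℝ) : ε / 2 ≤ posShift ε t := by
  unfold posShift
  split_ifs with ht
  · linarith
  · have := Real.exp_pos (2 * t / ε)
    nlinarith

/-- The approximations of `ρ` may be negative although `ρ` is not, so a positive `C¹` shift is
needed on the whole line. The exponential branch matches the value `ε` and the slope `1` at `0`. -/
theorem hasDerivAt_posShift (hε : 0 < ε) (t : ℝ) :
    HasDerivAt (posShift ε) (posShiftDeriv ε t) t := by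
  have hexp : ∀ s : ℝ, HasDerivAt (fun s => ε / 2 + ε / 2 * Real.exp (2 * s / ε))
      (Real.exp (2 * s / ε)) s := by
    intro s
    have h1 : HasDerivAt (fun s : ℝ => 2 * s / ε) (2 / ε) s := by
      simpa using ((hasDerivAt_id s).const_mul 2).div_const ε
    have h2 := (h1.exp.const_mul (ε / 2)).const_add (ε / 2)
    exact h2.congr_deriv (by field_simp)
  have hlin : ∀ s : ℝ, HasDerivAt (fun s => s + ε) 1 s := fun s => (hasDerivAt_id s).add_const ε
  have hneg : ∀ s, s ≤ 0 → posShift ε s = ε / 2 + ε / 2 * Real.exp (2 * s / ε) := by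
    intro s hs
    unfold posShift
    split_ifs with h
    · have : s = 0 := le_antisymm hs h
      subst this; simp
    · rfl
  have hnegd : ∀ s, s ≤ 0 → posShiftDeriv ε s = Real.exp (2 * s / ε) := fun s hs => by
    rw [posShiftDeriv, min_eq_right (div_nonpos_of_nonpos_of_nonneg (by linarith) hε.le)]
  have hL : t ≤ 0 → HasDerivWithinAt (posShift ε) (posShiftDeriv ε t) (Iic 0) t := fun ht => by
    rw [hnegd t ht]
    exact (hexp t).hasDerivWithinAt.congr (fun s hs => hneg s hs) (hneg t ht)
  have hR : 0 ≤ t → HasDerivWithinAt (posShift ε) (posShiftDeriv ε t) (Ici 0) t := fun ht => by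
    rw [posShiftDeriv_of_nonneg hε ht]
    exact (hlin t).hasDerivWithinAt.congr (fun s hs => posShift_of_nonneg hs)
      (posShift_of_nonneg ht)
  rcases lt_trichotomy t 0 with ht | rfl | ht
  · exact (hL ht.le).hasDerivAt (Iic_mem_nhds ht)
  · have := (hL le_rfl).union (hR le_rfl)
    rwa [Iic_union_Ici, hasDerivWithinAt_univ] at this
  · exact (hR ht.le).hasDerivAt (Ici_mem_nhds ht)

/-! ### Powers with linear growth -/

/-- The power `s ^ b`, modified so as to grow linearly if `δ > 0`. -/
def modPow (b δ s : ℝ) : ℝ := s ^ b * (1 + δ * s) ^ (1 - b)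

/-- The derivative of `modPow`. -/
def modPowDeriv (b δ s : ℝ) : ℝ := s ^ (b - 1) * ((1 + δ * s) ^ (-b) * (b + δ * s))

variable {b δ s p : ℝ}

theorem modPow_pos (hδ : 0 ≤ δ) (hs : 0 < s) : 0 < modPow b δ s := by
  unfold modPow; positivity

theorem hasDerivAt_modPow (hδ : 0 ≤ δ) (hs : 0 < s) :
    HasDerivAt (modPow b δ) (modPowDeriv b δ s) s := by
  have h0 : 0 < 1 + δ * s := by positivity
  have h1 : HasDerivAt (fun s : ℝ => 1 + δ * s) δ s := by
    simpa using ((hasDerivAt_id s).const_mul δ).const_add 1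
  have h2 := ((Real.hasDerivAt_rpow_const (p := b) (Or.inl hs.ne'))).mul
    (h1.rpow_const (p := 1 - b) (Or.inl h0.ne'))
  refine h2.congr_deriv ?_
  have e1 : s ^ b = s ^ (b - 1) * s := by
    rw [Real.rpow_sub_one hs.ne', div_mul_cancel₀ _ hs.ne']
  have e2 : (1 + δ * s) ^ (1 - b) = (1 + δ * s) ^ (-b) * (1 + δ * s) := by
    rw [show 1 - b = -b + 1 by ring, Real.rpow_add_one h0.ne']
  have e3 : (1 + δ * s) ^ (1 - b - 1) = (1 + δ * s) ^ (-b) := by ring_nf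
  rw [modPowDeriv, e1, e2, e3]
  ring

theorem continuousOn_modPowDeriv (hδ : 0 ≤ δ) : ContinuousOn (modPowDeriv b δ) (Ioi 0) := by
  intro s hs
  have hs' : (0 : ℝ) < s := hs
  have h0 : 0 < 1 + δ * s := by positivity
  refine ContinuousAt.continuousWithinAt ?_
  refine ContinuousAt.mul (Real.continuousAt_rpow_const _ _ (Or.inl hs'.ne')) ?_
  refine ContinuousAt.mul (ContinuousAt.rpow_const (by fun_prop) (Or.inl h0.ne')) (by fun_prop)

/-- With `b = α + 1 - p` the first factor is `s^α`, the weight in the theorem. The second equals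
`|b|^(1-p)` at `δ = 0`. -/
theorem modPow_rpow_mul (hδ : 0 ≤ δ) (hs : 0 < s) :
    modPow b δ s ^ p * |modPowDeriv b δ s| ^ (1 - p) =
      s ^ (b + p - 1) * ((1 + δ * s) ^ (p - b) * |b + δ * s| ^ (1 - p)) := by
  have h0 : 0 < 1 + δ * s := by positivity
  rw [modPow, modPowDeriv, abs_mul, abs_mul, abs_of_pos (Real.rpow_pos_of_pos hs _),
    abs_of_pos (Real.rpow_pos_of_pos h0 _), Real.mul_rpow (by positivity) (by positivity),
    Real.mul_rpow (by positivity) (by positivity), Real.mul_rpow (by positivity) (by positivity),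
    ← Real.rpow_mul hs.le, ← Real.rpow_mul h0.le, ← Real.rpow_mul hs.le, ← Real.rpow_mul h0.le]
  have e1 : s ^ (b + p - 1) = s ^ (b * p) * s ^ ((b - 1) * (1 - p)) := by
    rw [← Real.rpow_add hs]; ring_nf
  have e2 : (1 + δ * s) ^ (p - b) =
      (1 + δ * s) ^ ((1 - b) * p) * (1 + δ * s) ^ (-b * (1 - p)) := by
    rw [← Real.rpow_add h0]; ring_nf
  rw [e1, e2]
  ring

/-- The parameters for which `modPow` is monotone with bounded derivative away from `0`. -/
def IsModPowParam (b δ : ℝ) : Prop := (δ = 0 ∧ b ≤ 1 ∧ b ≠ 0) ∨ (0 < δ ∧ 1 < b)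

theorem IsModPowParam.nonneg (h : IsModPowParam b δ) : 0 ≤ δ := by
  rcases h with ⟨rfl, -⟩ | ⟨h, -⟩
  · exact le_rfl
  · exact h.le

theorem IsModPowParam.mul_pos (h : IsModPowParam b δ) (hs : 0 < s) : 0 < b * (b + δ * s) := by
  rcases h with ⟨rfl, -, hb⟩ | ⟨hδ, hb⟩
  · rw [zero_mul, add_zero]; exact mul_self_pos.2 hb
  · have : 0 < b := by linarith
    positivity

theorem IsModPowParam.mul_modPowDeriv_pos (h : IsModPowParam b δ) (hs : 0 < s) :
    0 < b * modPowDeriv b δ s := by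
  have h0 : 0 < 1 + δ * s := by have := h.nonneg; positivity
  have h1 := h.mul_pos hs
  calc 0 < s ^ (b - 1) * (1 + δ * s) ^ (-b) * (b * (b + δ * s)) := by positivity
    _ = _ := by rw [modPowDeriv]; ring

/-- For `δ = 0` the derivative is a multiple of a power with exponent `b - 1 ≤ 0`, largest in
absolute value at `r`. For `δ > 0` use `b + δ * s ≤ b * (1 + δ * s)` and `s / (1 + δ * s) ≤ 1 / δ`.
-/
theorem IsModPowParam.exists_bound (h : IsModPowParam b δ) {r : ℝ} (hr : 0 < r) :
    ∃ L, ∀ s, r ≤ s → |modPowDeriv b δ s| ≤ L := by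
  rcases h with ⟨rfl, hb, -⟩ | ⟨hδ, hb⟩
  · refine ⟨r ^ (b - 1) * |b|, fun s hs => ?_⟩
    have hs0 : 0 < s := hr.trans_le hs
    rw [modPowDeriv, zero_mul, add_zero, add_zero, Real.one_rpow, one_mul, abs_mul,
      abs_of_pos (Real.rpow_pos_of_pos hs0 _)]
    exact mul_le_mul_of_nonneg_right
      (Real.rpow_le_rpow_of_nonpos hr hs (by linarith)) (abs_nonneg _)
  · refine ⟨δ⁻¹ ^ (b - 1) * b, fun s hs => ?_⟩
    have hs0 : 0 < s := hr.trans_le hs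
    have hb0 : 0 < b := by linarith
    have h0 : 0 < 1 + δ * s := by positivity
    have e1 : (1 + δ * s) ^ (-b) * (1 + δ * s) = (1 + δ * s)⁻¹ ^ (b - 1) := by
      rw [← Real.rpow_add_one h0.ne', Real.inv_rpow h0.le, ← Real.rpow_neg h0.le]
      ring_nf
    have e2 : s * (1 + δ * s)⁻¹ ≤ δ⁻¹ := by
      rw [← div_eq_mul_inv, div_le_iff₀ h0]
      have : δ⁻¹ * (1 + δ * s) = δ⁻¹ + s := by field_simp
      rw [this]
      linarith [inv_pos.2 hδ]
    have hpos : 0 ≤ modPowDeriv b δ s := by unfold modPowDeriv; positivity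
    rw [abs_of_nonneg hpos, modPowDeriv]
    calc s ^ (b - 1) * ((1 + δ * s) ^ (-b) * (b + δ * s))
        ≤ s ^ (b - 1) * ((1 + δ * s) ^ (-b) * ((1 + δ * s) * b)) := by
          gcongr
          nlinarith [_root_.mul_pos hδ hs0]
      _ = s ^ (b - 1) * ((1 + δ * s) ^ (-b) * (1 + δ * s)) * b := by ring
      _ = (s * (1 + δ * s)⁻¹) ^ (b - 1) * b := by
          rw [e1, Real.mul_rpow hs0.le (by positivity)]
      _ ≤ _ := by gcongr

/-- A bound independent of `δ` and `s`, for dominated convergence. If `b > 1`, then `b + δ * s ≥ 1 +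
δ * s`, and the product is at most `(1 + δ * s)^(1-b) ≤ 1`. -/
theorem IsModPowParam.weight_le (h : IsModPowParam b δ) (hs : 0 < s) (hp : 1 < p) :
    (1 + δ * s) ^ (p - b) * |b + δ * s| ^ (1 - p) ≤ max (|b| ^ (1 - p)) 1 := by
  rcases h with ⟨rfl, -, -⟩ | ⟨hδ, hb⟩
  · simp
  · refine le_max_of_le_right ?_
    have h0 : 0 < 1 + δ * s := by positivity
    have h1 : 1 + δ * s ≤ |b + δ * s| := le_trans (by linarith) (le_abs_self _)
    calc (1 + δ * s) ^ (p - b) * |b + δ * s| ^ (1 - p)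
        ≤ (1 + δ * s) ^ (p - b) * (1 + δ * s) ^ (1 - p) := by
          exact mul_le_mul_of_nonneg_left (Real.rpow_le_rpow_of_nonpos h0 h1 (by linarith))
            (by positivity)
      _ = (1 + δ * s) ^ (1 - b) := by rw [← Real.rpow_add h0]; ring_nf
      _ ≤ 1 := Real.rpow_le_one_of_one_le_of_nonpos (by nlinarith [_root_.mul_pos hδ hs]) (by linarith)

end

section

/-! ### Passage to the limit in the truncation -/

theorem ofReal_mul_rpow {s r y : ℝ} (hs : 0 < s) :
    ENNReal.ofReal (s ^ r * y) = ENNReal.ofReal s ^ r * ENNReal.ofReal y := by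
  rw [ENNReal.ofReal_mul (by positivity), ENNReal.ofReal_rpow_of_pos hs]

theorem add_one_rpow_le {a : ℝ≥0∞} {α : ℝ} (hα : 0 ≤ α) :
    (a + 1) ^ α ≤ 2 ^ α * (a ^ α + 1) := by
  have h1 : a + 1 ≤ 2 * max a 1 := by
    rw [two_mul]; exact add_le_add (le_max_left _ _) (le_max_right _ _)
  calc (a + 1) ^ α ≤ (2 * max a 1) ^ α := ENNReal.rpow_le_rpow h1 hα
    _ = 2 ^ α * (max a 1) ^ α := ENNReal.mul_rpow_of_nonneg _ _ hα
    _ ≤ 2 ^ α * (a ^ α + 1) := by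
        gcongr
        rcases le_total a 1 with h | h
        · rw [max_eq_right h, ENNReal.one_rpow]; exact le_add_self
        · rw [max_eq_left h]; exact le_self_add

theorem tendsto_ofReal_add_rpow (r : ℝ) (t : ℝ) {ε : ℕ → ℝ} (hε : Tendsto ε atTop (𝓝 0)) :
    Tendsto (fun k => ENNReal.ofReal (t + ε k) ^ r) atTop (𝓝 (ENNReal.ofReal t ^ r)) := by
  have h1 : Tendsto (fun k => t + ε k) atTop (𝓝 t) := by
    simpa using hε.const_add t
  exact (ENNReal.continuous_rpow_const.tendsto _).comp
    ((ENNReal.continuous_ofReal.tendsto t).comp h1)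

theorem tendsto_weight {δ σ : ℕ → ℝ} {t b q r : ℝ} (hb : b ≠ 0) (hδ : Tendsto δ atTop (𝓝 0))
    (hσ : Tendsto σ atTop (𝓝 t)) :
    Tendsto (fun k => ENNReal.ofReal ((1 + δ k * σ k) ^ q * |b + δ k * σ k| ^ r)) atTop
      (𝓝 (ENNReal.ofReal (|b| ^ r))) := by
  refine (ENNReal.continuous_ofReal.tendsto _).comp ?_
  have h0 : Tendsto (fun k => δ k * σ k) atTop (𝓝 0) := by simpa using hδ.mul hσ
  have h1 : Tendsto (fun k => 1 + δ k * σ k) atTop (𝓝 1) := by simpa using h0.const_add 1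
  have h2 : Tendsto (fun k => |b + δ k * σ k|) atTop (𝓝 |b|) := by
    simpa using (h0.const_add b).abs
  have h3 := (h1.rpow_const (p := q) (Or.inl one_ne_zero)).mul
    (h2.rpow_const (p := r) (Or.inl (abs_pos.2 hb).ne'))
  rwa [Real.one_rpow, one_mul] at h3

variable {X : Type*} [MeasurableSpace X] {μ : Measure X} [IsFiniteMeasure μ] {p α c D : ℝ}
  {ρ N u m : X → ℝ}

/-- The inequality for `modPow b δ (ρ + ε)` is passed to the limit `ε, δ → 0`. Fatou's lemma handles
the left side without any integrability. On the right, if `α ≤ 0` the integrand increases to its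
limit value or stays below it, since `(ρ + ε)^α ≤ ρ^α`. If `α > 0`, a multiple of `(ρ + 1)^α`
dominates. -/
theorem lintegral_le_of_truncated (hp : 1 < p) (hc : c = p - 1 - α) (hc0 : c ≠ 0)
    (hρ : AEMeasurable ρ μ) (hρ0 : ∀ᵐ x ∂μ, 0 ≤ ρ x)
    (hN : ∀ x, 0 ≤ N x) (hNm : AEMeasurable N μ) (hu : AEMeasurable u μ)
    (hm : AEMeasurable m μ) (hm0 : ∀ x, 0 ≤ m x) (hmD : ∀ᵐ x ∂μ, m x ≤ D)
    (hα : 0 < α → ∫⁻ x, ENNReal.ofReal (ρ x) ^ α ∂μ ≠ ⊤)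
    (h : ∀ (ψ ψ' : ℝ → ℝ) (L : ℝ), (∀ t, HasDerivAt ψ (ψ' t) t) → Continuous ψ' →
      (∀ t, |ψ' t| ≤ L) → (∀ t, 0 < ψ t) → (∀ t, c * ψ' t < 0) →
      ∫⁻ x, ENNReal.ofReal (|u x| ^ p * |ψ' (ρ x)| * N x ^ p) ∂μ ≤
        ENNReal.ofReal p ^ p *
          ∫⁻ x, ENNReal.ofReal (ψ (ρ x) ^ p * |ψ' (ρ x)| ^ (1 - p) * m x ^ p) ∂μ) :
    ENNReal.ofReal ((|c| / p) ^ p) *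
        ∫⁻ x, ENNReal.ofReal (N x ^ p) / ENNReal.ofReal (ρ x) ^ (p - α) *
          ENNReal.ofReal (|u x| ^ p) ∂μ ≤
      ∫⁻ x, ENNReal.ofReal (ρ x) ^ α * ENNReal.ofReal (m x ^ p) ∂μ := by
  have hp0 : 0 < p := by linarith
  obtain ⟨b, rfl⟩ : ∃ b, c = -b := ⟨-c, by ring⟩
  have hb0 : b ≠ 0 := fun h => hc0 (by simp [h])
  have hb1 : b - 1 = α - p := by linarith
  have hb2 : b + p - 1 = α := by linarith
  rw [abs_neg]
  set ε : ℕ → ℝ := fun k => 1 / ((k : ℝ) + 1) with hεdef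
  have hε : ∀ k, 0 < ε k := fun k => Nat.one_div_pos_of_nat
  have hε1 : ∀ k, ε k ≤ 1 := fun k => by
    simp only [hεdef]
    rw [div_le_one (by positivity)]
    linarith [(Nat.cast_nonneg k : (0 : ℝ) ≤ k)]
  have hεlim : Tendsto ε atTop (𝓝 0) := tendsto_one_div_add_atTop_nhds_zero_nat
  -- Growth has to be tamed only for `b > 1`, that is `α > p`. In particular `δ = 0` when `α ≤ 0`,
  -- which the comparison on the right side relies on.
  obtain ⟨δ, hδ, hδlim, hδ0⟩ : ∃ δ : ℕ → ℝ, (∀ k, IsModPowParam b (δ k)) ∧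
      Tendsto δ atTop (𝓝 0) ∧ (α ≤ 0 → ∀ k, δ k = 0) := by
    rcases le_or_gt b 1 with hb | hb
    · exact ⟨fun _ => 0, fun _ => Or.inl ⟨rfl, hb, hb0⟩, tendsto_const_nhds, fun _ _ => rfl⟩
    · exact ⟨ε, fun k => Or.inr ⟨hε k, hb⟩, hεlim, fun hα => by linarith⟩
  set f : ℕ → X → ℝ≥0∞ := fun k x => ENNReal.ofReal (ρ x + ε k) ^ (b - 1) *
    ENNReal.ofReal ((1 + δ k * (ρ x + ε k)) ^ (-b) * |b + δ k * (ρ x + ε k)| ^ (1 : ℝ)) *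
    ENNReal.ofReal (|u x| ^ p * N x ^ p) with hf
  set g : ℕ → X → ℝ≥0∞ := fun k x => ENNReal.ofReal (ρ x + ε k) ^ α *
    ENNReal.ofReal ((1 + δ k * (ρ x + ε k)) ^ (p - b) * |b + δ k * (ρ x + ε k)| ^ (1 - p)) *
    ENNReal.ofReal (m x ^ p) with hg
  have hshift : ∀ k, AEMeasurable (fun x => ρ x + ε k) μ := fun k => hρ.add_const _
  have hw : ∀ (k : ℕ) (q r : ℝ), AEMeasurable (fun x => ENNReal.ofReal
      ((1 + δ k * (ρ x + ε k)) ^ q * |b + δ k * (ρ x + ε k)| ^ r)) μ := fun k q r =>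
    (((((hshift k).const_mul _).const_add _).pow_const _).mul
      ((((hshift k).const_mul _).const_add _).norm.pow_const _)).ennreal_ofReal
  have hum : AEMeasurable (fun x => |u x| ^ p * N x ^ p) μ :=
    (hu.norm.pow_const p).mul (hNm.pow_const p)
  have hfm : ∀ k, AEMeasurable (f k) μ := fun k =>
    (((hshift k).ennreal_ofReal.pow_const (b - 1)).mul (hw k (-b) 1)).mul hum.ennreal_ofReal
  have hgm : ∀ k, AEMeasurable (g k) μ := fun k =>
    (((hshift k).ennreal_ofReal.pow_const α).mul (hw k (p - b) (1 - p))).mul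
      (hm.pow_const p).ennreal_ofReal
  have hfg : ∀ k, ∫⁻ x, f k x ∂μ ≤ ENNReal.ofReal p ^ p * ∫⁻ x, g k x ∂μ := by
    intro k
    have hpos : ∀ t, 0 < posShift (ε k) t := fun t =>
      (half_pos (hε k)).trans_le (half_le_posShift (hε k) t)
    obtain ⟨L, hL⟩ := (hδ k).exists_bound (half_pos (hε k))
    have hcont : Continuous (posShift (ε k)) :=
      continuous_iff_continuousAt.2 fun t => (hasDerivAt_posShift (hε k) t).continuousAt
    have hk := h (fun t => modPow b (δ k) (posShift (ε k) t))
      (fun t => modPowDeriv b (δ k) (posShift (ε k) t) * posShiftDeriv (ε k) t) L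
      (fun t => (hasDerivAt_modPow (hδ k).nonneg (hpos t)).comp t
        (hasDerivAt_posShift (hε k) t))
      (((continuousOn_modPowDeriv (hδ k).nonneg).comp_continuous hcont hpos).mul
        continuous_posShiftDeriv)
      (fun t => by
        rw [abs_mul, abs_of_pos (posShiftDeriv_pos t)]
        exact (mul_le_of_le_one_right (abs_nonneg _) (posShiftDeriv_le_one t)).trans
          (hL _ (half_le_posShift (hε k) t)))
      (fun t => modPow_pos (hδ k).nonneg (hpos t))
      (fun t => by
        have := mul_pos ((hδ k).mul_modPowDeriv_pos (hpos t)) (posShiftDeriv_pos (ε := ε k) t)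
        linarith)
    have e1 : ∫⁻ x, f k x ∂μ = ∫⁻ x, ENNReal.ofReal (|u x| ^ p *
        |modPowDeriv b (δ k) (posShift (ε k) (ρ x)) * posShiftDeriv (ε k) (ρ x)| * N x ^ p) ∂μ := by
      refine lintegral_congr_ae (hρ0.mono fun x hx => ?_)
      have hs : 0 < ρ x + ε k := add_pos_of_nonneg_of_pos hx (hε k)
      have h0 : 0 < 1 + δ k * (ρ x + ε k) := by have := (hδ k).nonneg; positivity
      have hNx := hN x
      simp only [hf]
      rw [posShiftDeriv_of_nonneg (hε k) hx, mul_one, posShift_of_nonneg hx, modPowDeriv,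
        abs_mul, abs_mul, abs_of_pos (Real.rpow_pos_of_pos hs _),
        abs_of_pos (Real.rpow_pos_of_pos h0 _), Real.rpow_one, ← ofReal_mul_rpow hs,
        ← ENNReal.ofReal_mul (by positivity)]
      congr 1
      ring
    have e2 : ∫⁻ x, g k x ∂μ = ∫⁻ x, ENNReal.ofReal (modPow b (δ k) (posShift (ε k) (ρ x)) ^ p *
        |modPowDeriv b (δ k) (posShift (ε k) (ρ x)) * posShiftDeriv (ε k) (ρ x)| ^ (1 - p) *
        m x ^ p) ∂μ := by
      refine lintegral_congr_ae (hρ0.mono fun x hx => ?_)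
      have hs : 0 < ρ x + ε k := add_pos_of_nonneg_of_pos hx (hε k)
      have h0 : 0 < 1 + δ k * (ρ x + ε k) := by have := (hδ k).nonneg; positivity
      simp only [hg]
      rw [posShiftDeriv_of_nonneg (hε k) hx, mul_one, posShift_of_nonneg hx,
        modPow_rpow_mul (hδ k).nonneg hs, hb2, ← ofReal_mul_rpow hs,
        ← ENNReal.ofReal_mul (by positivity)]
    rw [e1, e2]
    exact hk
  have hσ : ∀ t : ℝ, Tendsto (fun k => t + ε k) atTop (𝓝 t) := fun t => by
    simpa using hεlim.const_add t
  have hflim : ∀ x, Tendsto (fun k => f k x) atTop (𝓝 (ENNReal.ofReal (ρ x) ^ (b - 1) *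
      ENNReal.ofReal (|b| ^ (1 : ℝ)) * ENNReal.ofReal (|u x| ^ p * N x ^ p))) := by
    intro x
    -- Where `ρ = 0` the power may tend to `∞`. The product still converges because the limit of the
    -- weight is nonzero, and the last factor is constant, so `0 * ∞ = 0` agrees with the limit
    -- where `u` or `N` vanishes.
    have hbpos : ENNReal.ofReal (|b| ^ (1 : ℝ)) ≠ 0 := by
      simpa using hb0
    exact ENNReal.Tendsto.mul_const (ENNReal.Tendsto.mul (tendsto_ofReal_add_rpow _ _ hεlim)
      (Or.inr ENNReal.ofReal_ne_top) (tendsto_weight hb0 hδlim (hσ _)) (Or.inl hbpos))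
      (Or.inr ENNReal.ofReal_ne_top)
  set R : ℝ≥0∞ := ∫⁻ x, ENNReal.ofReal (ρ x) ^ α * ENNReal.ofReal (|b| ^ (1 - p)) *
    ENNReal.ofReal (m x ^ p) ∂μ with hR
  have hglim : liminf (fun k => ∫⁻ x, g k x ∂μ) atTop ≤ R := by
    rcases le_or_gt α 0 with hα0 | hα0
    · refine liminf_le_of_le (by isBoundedDefault) fun y hy => ?_
      obtain ⟨k, hk⟩ := hy.exists
      refine hk.trans (lintegral_mono_ae (hρ0.mono fun x hx => ?_))
      simp only [hg, hδ0 hα0 k, zero_mul, add_zero, Real.one_rpow, one_mul]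
      gcongr ?_ * _ * _
      have hle : ENNReal.ofReal (ρ x) ≤ ENNReal.ofReal (ρ x + ε k) :=
        ENNReal.ofReal_le_ofReal (by linarith [hε k])
      have h1 := ENNReal.rpow_le_rpow hle (neg_nonneg.2 hα0)
      rw [ENNReal.rpow_neg, ENNReal.rpow_neg] at h1
      exact ENNReal.inv_le_inv.1 h1
    · refine (Tendsto.liminf_eq (tendsto_lintegral_of_dominated_convergence'
        (fun x => ENNReal.ofReal (ρ x + 1) ^ α * ENNReal.ofReal (max (|b| ^ (1 - p)) 1) *
          ENNReal.ofReal (D ^ p)) hgm (fun k => ?_) ?_ ?_)).le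
      · filter_upwards [hρ0, hmD] with x hx hxD
        have hs : 0 < ρ x + ε k := add_pos_of_nonneg_of_pos hx (hε k)
        exact mul_le_mul' (mul_le_mul' (ENNReal.rpow_le_rpow
          (ENNReal.ofReal_le_ofReal (by linarith [hε1 k])) hα0.le)
          (ENNReal.ofReal_le_ofReal ((hδ k).weight_le hs hp)))
          (ENNReal.ofReal_le_ofReal (Real.rpow_le_rpow (hm0 x) hxD hp0.le))
      · rw [lintegral_mul_const' _ _ ENNReal.ofReal_ne_top,
          lintegral_mul_const' _ _ ENNReal.ofReal_ne_top]
        refine ENNReal.mul_ne_top (ENNReal.mul_ne_top ?_ ENNReal.ofReal_ne_top)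
          ENNReal.ofReal_ne_top
        have hle : ∫⁻ x, ENNReal.ofReal (ρ x + 1) ^ α ∂μ ≤
            ∫⁻ x, 2 ^ α * (ENNReal.ofReal (ρ x) ^ α + 1) ∂μ := by
          refine lintegral_mono_ae (hρ0.mono fun x hx => ?_)
          rw [ENNReal.ofReal_add hx zero_le_one, ENNReal.ofReal_one]
          exact add_one_rpow_le hα0.le
        refine ne_top_of_le_ne_top ?_ hle
        have h2 : (2 : ℝ≥0∞) ^ α ≠ ⊤ := ENNReal.rpow_ne_top_of_nonneg hα0.le (by norm_num)
        rw [lintegral_const_mul' _ _ h2, lintegral_add_right _ measurable_const, lintegral_one]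
        exact ENNReal.mul_ne_top h2 (ENNReal.add_ne_top.2 ⟨hα hα0, measure_ne_top _ _⟩)
      · refine Eventually.of_forall fun x => ?_
        have hbpos : ENNReal.ofReal (|b| ^ (1 - p)) ≠ 0 := by
          simpa using Real.rpow_pos_of_pos (abs_pos.2 hb0) _
        exact ENNReal.Tendsto.mul_const (ENNReal.Tendsto.mul (tendsto_ofReal_add_rpow _ _ hεlim)
          (Or.inr ENNReal.ofReal_ne_top) (tendsto_weight hb0 hδlim (hσ _)) (Or.inl hbpos))
          (Or.inr ENNReal.ofReal_ne_top)
  have hpp : ENNReal.ofReal p ^ p ≠ ⊤ :=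
    ENNReal.rpow_ne_top_of_nonneg hp0.le ENNReal.ofReal_ne_top
  have hmain : ∫⁻ x, ENNReal.ofReal (ρ x) ^ (b - 1) * ENNReal.ofReal (|b| ^ (1 : ℝ)) *
      ENNReal.ofReal (|u x| ^ p * N x ^ p) ∂μ ≤ ENNReal.ofReal p ^ p * R := by
    calc _ = ∫⁻ x, liminf (fun k => f k x) atTop ∂μ :=
          lintegral_congr fun x => (hflim x).liminf_eq.symm
      _ ≤ liminf (fun k => ∫⁻ x, f k x ∂μ) atTop := lintegral_liminf_le' hfm
      _ ≤ liminf (fun k => ENNReal.ofReal p ^ p * ∫⁻ x, g k x ∂μ) atTop :=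
          liminf_le_liminf (Eventually.of_forall hfg)
      _ = ENNReal.ofReal p ^ p * liminf (fun k => ∫⁻ x, g k x ∂μ) atTop :=
          ENNReal.liminf_const_mul_of_ne_top hpp
      _ ≤ _ := by gcongr
  set I : ℝ≥0∞ := ∫⁻ x, ENNReal.ofReal (N x ^ p) / ENNReal.ofReal (ρ x) ^ (p - α) *
    ENNReal.ofReal (|u x| ^ p) ∂μ with hI
  set J : ℝ≥0∞ := ∫⁻ x, ENNReal.ofReal (ρ x) ^ α * ENNReal.ofReal (m x ^ p) ∂μ with hJ
  have hI' : ∫⁻ x, ENNReal.ofReal (ρ x) ^ (b - 1) * ENNReal.ofReal (|b| ^ (1 : ℝ)) *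
      ENNReal.ofReal (|u x| ^ p * N x ^ p) ∂μ = ENNReal.ofReal |b| * I := by
    rw [hI, ← lintegral_const_mul' _ _ ENNReal.ofReal_ne_top]
    refine lintegral_congr fun x => ?_
    rw [Real.rpow_one, ENNReal.ofReal_mul (Real.rpow_nonneg (abs_nonneg _) _), div_eq_mul_inv,
      ← ENNReal.rpow_neg, neg_sub, hb1]
    ring
  have hR' : R = ENNReal.ofReal (|b| ^ (1 - p)) * J := by
    rw [hR, hJ, ← lintegral_const_mul' _ _ ENNReal.ofReal_ne_top]
    refine lintegral_congr fun x => ?_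
    ring
  rw [hI', hR', ENNReal.ofReal_rpow_of_pos hp0] at hmain
  have hbp : 0 < |b| := abs_pos.2 hb0
  -- At this point `|b| * I ≤ p^p * |b|^(1-p) * J`. Multiplying by `|b|^(p-1) / p^p` produces the
  -- constant of the theorem.
  have hk : ENNReal.ofReal ((|b| / p) ^ p) =
      ENNReal.ofReal (|b| ^ (p - 1) * (p ^ p)⁻¹) * ENNReal.ofReal |b| := by
    rw [← ENNReal.ofReal_mul (by positivity)]
    congr 1
    rw [Real.div_rpow hbp.le hp0.le, Real.rpow_sub_one hbp.ne']
    field_simp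
  have hk2 : ENNReal.ofReal (|b| ^ (p - 1) * (p ^ p)⁻¹) *
      (ENNReal.ofReal (p ^ p) * (ENNReal.ofReal (|b| ^ (1 - p)) * J)) = J := by
    rw [← mul_assoc, ← mul_assoc, ← ENNReal.ofReal_mul (by positivity),
      ← ENNReal.ofReal_mul (by positivity)]
    have : |b| ^ (p - 1) * (p ^ p)⁻¹ * p ^ p * |b| ^ (1 - p) = 1 := by
      rw [mul_assoc (|b| ^ (p - 1)), inv_mul_cancel₀ (by positivity), mul_one,
        ← Real.rpow_add hbp]
      simp
    rw [this, ENNReal.ofReal_one, one_mul]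
  calc ENNReal.ofReal ((|b| / p) ^ p) * I
      = ENNReal.ofReal (|b| ^ (p - 1) * (p ^ p)⁻¹) * (ENNReal.ofReal |b| * I) := by
        rw [hk, mul_assoc]
    _ ≤ _ := mul_le_mul_right hmain _
    _ = J := hk2

end

section

/-! ### Test functions built from approximations -/

theorem integrable_rpow_of_le_add {X : Type*} [MeasurableSpace X] {μ : Measure X} {p : ℝ}
    (hp : 0 ≤ p) {f g h : X → ℝ} (hf : AEMeasurable f μ) (hg : AEMeasurable g μ)
    (hh : AEMeasurable h μ) (hf0 : ∀ x, 0 ≤ f x) (hg0 : ∀ x, 0 ≤ g x) (hh0 : ∀ x, 0 ≤ h x)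
    (hle : ∀ᵐ x ∂μ, f x ≤ g x + h x)
    (hgp : ∫⁻ x, ENNReal.ofReal (g x ^ p) ∂μ ≠ ⊤) (hhp : ∫⁻ x, ENNReal.ofReal (h x ^ p) ∂μ ≠ ⊤) :
    Integrable (fun x => f x ^ p) μ := by
  have key : ∀ k : X → ℝ, AEMeasurable k μ → (∀ x, 0 ≤ k x) →
      ∫⁻ x, ENNReal.ofReal (k x ^ p) ∂μ ≠ ⊤ → Integrable (fun x => k x ^ p) μ :=
    fun k hk hk0 hkp => ⟨(hk.pow_const p).aestronglyMeasurable,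
      (hasFiniteIntegral_iff_ofReal (Eventually.of_forall fun x => Real.rpow_nonneg (hk0 x) p)).2
        hkp.lt_top⟩
  refine (((key g hg hg0 hgp).add (key h hh hh0 hhp)).const_mul (2 ^ p)).mono'
    (hf.pow_const p).aestronglyMeasurable ?_
  filter_upwards [hle] with x hx
  have h1 := hg0 x
  have h2 := hh0 x
  have hmax : 0 ≤ max (g x) (h x) := le_max_of_le_left h1
  rw [Real.norm_eq_abs, abs_of_nonneg (Real.rpow_nonneg (hf0 x) p)]
  calc f x ^ p ≤ (2 * max (g x) (h x)) ^ p := Real.rpow_le_rpow (hf0 x)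
        (by linarith [le_max_left (g x) (h x), le_max_right (g x) (h x)]) hp
    _ = 2 ^ p * max (g x) (h x) ^ p := Real.mul_rpow (by norm_num) hmax
    _ ≤ 2 ^ p * (g x ^ p + h x ^ p) := by
        gcongr
        have h3 := Real.rpow_nonneg h1 p
        have h4 := Real.rpow_nonneg h2 p
        rcases max_choice (g x) (h x) with h | h <;> rw [h] <;> linarith

/-- Where `N = 0` the value of `N^(p-2)` is irrelevant, because the hypothesis forces `y = 0`. This
covers the singular range `p < 2`. -/
theorem abs_rpow_sub_two_mul_le {N y m p : ℝ} (hp : 1 < p) (hN : 0 ≤ N) (hy : |y| ≤ m * N) :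
    |N ^ (p - 2) * y| ≤ N ^ (p - 1) * m := by
  rcases hN.eq_or_lt with rfl | hN
  · rw [mul_zero] at hy
    rw [abs_nonpos_iff.1 hy, mul_zero, abs_zero, Real.zero_rpow (by linarith), zero_mul]
  · rw [abs_mul, abs_of_pos (Real.rpow_pos_of_pos hN _)]
    calc N ^ (p - 2) * |y| ≤ N ^ (p - 2) * (m * N) := by gcongr
      _ = N ^ (p - 2 + 1) * m := by rw [Real.rpow_add_one hN.ne']; ring
      _ = _ := by ring_nf

theorem rpow_sub_two_mul_sq {N p : ℝ} (hp : 1 < p) (hN : 0 ≤ N) :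
    N ^ (p - 2) * N ^ 2 = N ^ p := by
  rcases hN.eq_or_lt with rfl | hN
  · rw [Real.zero_rpow (by linarith : p ≠ 0)]; simp
  · rw [← Real.rpow_natCast, ← Real.rpow_add hN]; norm_num

variable {n : ℕ} {M : Type*} [TopologicalSpace M] [ChartedSpace (EuclideanSpace ℝ (Fin n)) M]

theorem differential_mul_comp_apply {f g : M → ℝ} {h k : ℝ → ℝ} {h' k' : ℝ} {x : M}
    (hh : HasDerivAt h h' (f x)) (hk : HasDerivAt k k' (g x))
    (hf : MDifferentiableAt (𝓡 n) 𝓘(ℝ, ℝ) f x) (hg : MDifferentiableAt (𝓡 n) 𝓘(ℝ, ℝ) g x)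
    (v : TangentSpace (𝓡 n) x) :
    differential (n := n) (fun y => h (f y) * k (g y)) x v =
      k (g x) * (h' * differential (n := n) f x v) +
        h (f x) * (k' * differential (n := n) g x v) := by
  have h1 : HasMFDerivAt (𝓡 n) 𝓘(ℝ, ℝ) (fun y => h (f y)) x
      ((ContinuousLinearMap.toSpanSingleton ℝ h').comp (differential (n := n) f x)) :=
    hh.hasFDerivAt.hasMFDerivAt.comp x hf.hasMFDerivAt
  have h2 : HasMFDerivAt (𝓡 n) 𝓘(ℝ, ℝ) (fun y => k (g y)) x
      ((ContinuousLinearMap.toSpanSingleton ℝ k').comp (differential (n := n) g x)) :=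
    hk.hasFDerivAt.hasMFDerivAt.comp x hg.hasMFDerivAt
  have h3 := (h1.mul h2).mfderiv
  have h4 : differential (n := n) (fun y => h (f y) * k (g y)) x =
      h (f x) • (ContinuousLinearMap.toSpanSingleton ℝ k').comp (differential (n := n) g x) +
      k (g x) • (ContinuousLinearMap.toSpanSingleton ℝ h').comp (differential (n := n) f x) := h3
  rw [h4]
  change h (f x) * (differential (n := n) g x v * k') +
    k (g x) * (differential (n := n) f x v * h') = _
  ring

theorem differential_of_notMem_tsupport {f : M → ℝ} {x : M} (hx : x ∉ tsupport f) :
    differential (n := n) f x = 0 := by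
  have h1 : f =ᶠ[𝓝 x] fun _ => (0 : ℝ) := notMem_tsupport_iff_eventuallyEq.1 hx
  exact (h1.mfderiv_eq).trans mfderiv_const

/-- Here `|t|^p` is `C¹` because `p > 1`. The function `φ` is controlled only on `U`, which suffices
since the product vanishes near every point off the support of `u`. -/
theorem isTestFunction_abs_rpow_mul [IsManifold (𝓡 n) ∞ M] {Ω U : Set M} {u φ : M → ℝ}
    {ψ ψ' : ℝ → ℝ} {p : ℝ} (hp : 1 < p) (hu : IsTestFunction n ∞ Ω u) (hU : IsOpen U)
    (huU : tsupport u ⊆ U) (hφ : ContMDiffOn (𝓡 n) 𝓘(ℝ, ℝ) 1 φ U)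
    (hψ : ∀ t, HasDerivAt ψ (ψ' t) t) (hψ' : Continuous ψ') :
    IsTestFunction n 1 Ω fun x => |u x| ^ p * ψ (φ x) := by
  have hsupp : tsupport (fun x => |u x| ^ p * ψ (φ x)) ⊆ tsupport u := by
    refine closure_mono fun x hx => ?_
    rw [Function.mem_support] at hx ⊢
    intro h
    apply hx
    simp [h, Real.zero_rpow (by linarith : p ≠ 0)]
  have hψC : ContDiff ℝ 1 ψ := by
    rw [contDiff_one_iff_deriv]
    exact ⟨fun t => (hψ t).differentiableAt, by
      rwa [show deriv ψ = ψ' from funext fun t => (hψ t).deriv]⟩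
  have habs : ContDiff ℝ 1 fun t : ℝ => |t| ^ p := by
    simpa using contDiff_norm_rpow (E := ℝ) hp
  refine ⟨fun x => ?_, hu.2.1.of_isClosed_subset (isClosed_tsupport _) hsupp,
    hsupp.trans hu.2.2⟩
  by_cases hx : x ∈ tsupport u
  · have h1 : ContMDiffAt (𝓡 n) 𝓘(ℝ, ℝ) 1 u x :=
      (hu.1 x).of_le (WithTop.coe_le_coe.2 (le_top : (1 : ℕ∞) ≤ ⊤))
    have h2 := hφ.contMDiffAt (hU.mem_nhds (huU hx))
    exact (habs.contMDiff.contMDiffAt.comp x h1).mul (hψC.contMDiff.contMDiffAt.comp x h2)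
  · have h1 : (fun x => |u x| ^ p * ψ (φ x)) =ᶠ[𝓝 x] fun _ => (0 : ℝ) :=
      notMem_tsupport_iff_eventuallyEq.1 fun h => hx (hsupp h)
    exact contMDiffAt_const.congr_of_eventuallyEq h1

/-! ### The weak inequality with Lipschitz functions of `ρ` -/

variable [SecondCountableTopology M] [IsManifold (𝓡 n) ∞ M] [MeasurableSpace M]
  [BorelSpace M] {F : TangentBundle (𝓡 n) M → ℝ} {𝔪 : Measure M} {Ω U : Set M} {p c : ℝ}
  {ρ u : M → ℝ} {dρ : (x : M) → Cotangent n x}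

/-- The norm of the gradient of a function with differential `η`. -/
def gradNorm (F : TangentBundle (𝓡 n) M → ℝ) (η : (x : M) → Cotangent n x) (x : M) : ℝ :=
  F ⟨x, legendreInv F x (η x)⟩

/-- One approximation of finite energy at finite distance is enough. The triangle inequality for `dρ
= dφ - (dφ - dρ)` meets `F*` of the negative of `dφ - dρ`, hence the reversibility constant. -/
theorem HasWeakDifferential.integrable (hF : IsFinslerMetric F) (hp : 1 < p)
    (hρ : HasWeakDifferential F 𝔪 p Ω ρ dρ) (hU : IsOpen U)
    (hUc : IsCompact (closure U)) (hUΩ : closure U ⊆ Ω) :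
    Integrable (fun x => |ρ x| ^ p) (𝔪.restrict U) ∧
      Integrable (fun x => gradNorm F dρ x ^ p) (𝔪.restrict U) := by
  have hp0 : 0 ≤ p := by linarith
  have hUΩ' : U ⊆ Ω := subset_closure.trans hUΩ
  obtain ⟨φ, hφ, hlim⟩ := hρ.approx U hU hUc hUΩ
  obtain ⟨j, hj⟩ := (hlim.eventually_lt_const ENNReal.zero_lt_top).exists
  obtain ⟨hφj, hfin⟩ := hφ j
  have hφ1 : ContMDiffOn (𝓡 n) 𝓘(ℝ, ℝ) 1 (φ j) U :=
    hφj.of_le (WithTop.coe_le_coe.2 (le_top : (1 : ℕ∞) ≤ ⊤))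
  obtain ⟨hfin1, hfin2⟩ := ENNReal.add_ne_top.1 hfin
  obtain ⟨hd1, hd2⟩ := ENNReal.add_ne_top.1 hj.ne
  have hρm : AEMeasurable ρ (𝔪.restrict U) :=
    hρ.aemeasurable.mono_measure (Measure.restrict_mono hUΩ' le_rfl)
  have hφm : AEMeasurable (φ j) (𝔪.restrict U) :=
    hφj.continuousOn.aemeasurable hU.measurableSet
  have hdρ := hρ.measurable_differential.mono hUΩ'
  have hdφ := isMeasurableCovectorField_differential (𝔪 := 𝔪) hU hφ1
  obtain ⟨C, hC, hrev⟩ := hF.exists_reversibility_bound hUc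
  constructor
  · refine integrable_rpow_of_le_add hp0 hρm.norm hφm.norm (hφm.sub hρm).norm
      (fun x => abs_nonneg _) (fun x => abs_nonneg _) (fun x => abs_nonneg _)
      (Eventually.of_forall fun x => ?_) hfin1 hd1
    have := norm_sub_le (φ j x) (φ j x - ρ x)
    simpa using this
  · have hm1 := (hdφ.sub hdρ).aemeasurable_dualMetric hU.measurableSet hF
    have hm2 : AEMeasurable (fun x => gradNorm F dρ x) (𝔪.restrict U) :=
      (hdρ.aemeasurable_dualMetric hU.measurableSet hF).congr
        (Eventually.of_forall fun x => hF.dualMetric_eq x (dρ x))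
    refine integrable_rpow_of_le_add hp0 hm2
      (hdφ.aemeasurable_dualMetric hU.measurableSet hF) (hm1.const_mul C)
      (fun x => hF.nonneg _) (fun x => hF.dualMetric_nonneg _ _)
      (fun x => mul_nonneg hC (hF.dualMetric_nonneg _ _)) ?_ hfin2 ?_
    · filter_upwards [ae_restrict_mem hU.measurableSet] with x hx
      have h1 := hF.dualMetric_neg_le hC (hrev x (subset_closure hx))
        (differential (φ j) x - dρ x)
      have h2 := hF.dualMetric_add_le x (differential (φ j) x) (-(differential (φ j) x - dρ x))
      have h3 : differential (φ j) x + -(differential (φ j) x - dρ x) = dρ x := by abel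
      rw [h3, hF.dualMetric_eq x (dρ x)] at h2
      exact h2.trans (add_le_add le_rfl h1)
    · have h1 : ∀ x, ENNReal.ofReal ((C * dualMetric F x (differential (φ j) x - dρ x)) ^ p) =
          ENNReal.ofReal (C ^ p) *
            ENNReal.ofReal (dualMetric F x (differential (φ j) x - dρ x) ^ p) := fun x => by
        rw [Real.mul_rpow hC (hF.dualMetric_nonneg _ _), ENNReal.ofReal_mul (by positivity)]
      simp_rw [h1]
      rw [lintegral_const_mul' _ _ ENNReal.ofReal_ne_top]
      exact ENNReal.mul_ne_top ENNReal.ofReal_ne_top hd2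

/-- The pairing `F^{p-2}(∇ρ) dv(∇ρ)`. -/
def pairing (F : TangentBundle (𝓡 n) M → ℝ) (p : ℝ) (dρ : (x : M) → Cotangent n x)
    (v : M → ℝ) (x : M) : ℝ :=
  gradNorm F dρ x ^ (p - 2) * differential (n := n) v x (legendreInv F x (dρ x))

/-- The functions `|u|^p ψ(φ_j)` are admissible, and their inequalities pass to the limit. The
gradient `∇ρ` is kept fixed throughout: only the differential of the test function is approximated,
so no continuity of the nonlinear operator is needed. -/
theorem WeakNegPLaplacianNonneg.exists_limit (hF : IsFinslerMetric F) (hp : 1 < p)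
    (h𝔪 : IsLocallyFiniteMeasure 𝔪)
    (hΩ : IsOpen Ω) (hρ : HasWeakDifferential F 𝔪 p Ω ρ dρ)
    (hweak : WeakNegPLaplacianNonneg F 𝔪 p c Ω dρ) (hu : IsTestFunction n ∞ Ω u) (hU : IsOpen U)
    (hUc : IsCompact (closure U)) (hUΩ : closure U ⊆ Ω) (huU : tsupport u ⊆ U)
    {ψ ψ' : ℝ → ℝ} {L : ℝ} (hψ : ∀ t, HasDerivAt ψ (ψ' t) t) (hψ' : Continuous ψ')
    (hL : ∀ t, |ψ' t| ≤ L) (hψpos : ∀ t, 0 < ψ t) {A B : ℝ} (hA : 0 ≤ A) (hB : 0 ≤ B)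
    (huB : ∀ x, |u x| ^ p ≤ B)
    (ham : AEMeasurable (fun x => p * |u x| ^ (p - 2) * u x * pairing F p dρ u x) (𝔪.restrict U))
    (haA : ∀ᵐ x ∂(𝔪.restrict U), |p * |u x| ^ (p - 2) * u x * pairing F p dρ u x| ≤
      A * gradNorm F dρ x ^ (p - 1)) :
    0 ≤ c * ∫ x in U, ψ (ρ x) * (p * |u x| ^ (p - 2) * u x * pairing F p dρ u x) +
      |u x| ^ p * ψ' (ρ x) * gradNorm F dρ x ^ p ∂𝔪 := by
  have hp0 : 0 ≤ p := by linarith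
  have hUΩ' : U ⊆ Ω := subset_closure.trans hUΩ
  have : IsFiniteMeasure (𝔪.restrict U) := ⟨by
    rw [Measure.restrict_apply_univ]
    exact (measure_mono subset_closure).trans_lt hUc.measure_lt_top⟩
  obtain ⟨hρp, hNp⟩ := hρ.integrable hF hp hU hUc hUΩ
  obtain ⟨φ, hφ, hlim⟩ := hρ.approx U hU hUc hUΩ
  have hφ1 : ∀ j, ContMDiffOn (𝓡 n) 𝓘(ℝ, ℝ) 1 (φ j) U := fun j =>
    (hφ j).1.of_le (WithTop.coe_le_coe.2 (le_top : (1 : ℕ∞) ≤ ⊤))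
  have hρm : AEMeasurable ρ (𝔪.restrict U) :=
    hρ.aemeasurable.mono_measure (Measure.restrict_mono hUΩ' le_rfl)
  have hφm : ∀ j, AEMeasurable (φ j) (𝔪.restrict U) := fun j =>
    (hφ j).1.continuousOn.aemeasurable hU.measurableSet
  have hdρ := hρ.measurable_differential.mono hUΩ'
  have hdφ := fun j => isMeasurableCovectorField_differential (𝔪 := 𝔪) hU (hφ1 j)
  have hNm : AEMeasurable (gradNorm F dρ) (𝔪.restrict U) :=
    (hdρ.aemeasurable_dualMetric hU.measurableSet hF).congr
      (Eventually.of_forall fun x => hF.dualMetric_eq x (dρ x))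
  obtain ⟨C, hC, hrev⟩ := hF.exists_reversibility_bound hUc
  have hlim1 := tendsto_of_tendsto_of_tendsto_of_le_of_le tendsto_const_nhds hlim
    (fun _ => zero_le) fun j => (le_self_add :
      ∫⁻ x in U, ENNReal.ofReal (|φ j x - ρ x| ^ p) ∂𝔪 ≤ _)
  have hlim2 := tendsto_of_tendsto_of_tendsto_of_le_of_le tendsto_const_nhds hlim
    (fun _ => zero_le) fun j => (le_add_self :
      ∫⁻ x in U, ENNReal.ofReal (dualMetric F x (differential (φ j) x - dρ x) ^ p) ∂𝔪 ≤ _)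
  -- The factor `1 + C` dominates `F*` of both `dφ_j - dρ` and its negative.
  have hD0 : ∀ j x, 0 ≤ (1 + C) * dualMetric F x (differential (φ j) x - dρ x) := fun j x =>
    mul_nonneg (by positivity) (hF.dualMetric_nonneg _ _)
  have hDp : Tendsto (fun j => ∫⁻ x in U, ENNReal.ofReal
      (((1 + C) * dualMetric F x (differential (φ j) x - dρ x)) ^ p) ∂𝔪) atTop (𝓝 0) := by
    have h1 : ∀ j x, ENNReal.ofReal
        (((1 + C) * dualMetric F x (differential (φ j) x - dρ x)) ^ p) =
        ENNReal.ofReal ((1 + C) ^ p) *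
          ENNReal.ofReal (dualMetric F x (differential (φ j) x - dρ x) ^ p) := fun j x => by
      rw [Real.mul_rpow (by positivity) (hF.dualMetric_nonneg _ _),
        ENNReal.ofReal_mul (by positivity)]
    simp_rw [h1]
    simp_rw [lintegral_const_mul' _ _ ENNReal.ofReal_ne_top]
    have h2 := ENNReal.Tendsto.const_mul hlim2 (Or.inr (ENNReal.ofReal_ne_top (r := (1 + C) ^ p)))
    rwa [mul_zero] at h2
  have hTD : ∀ j, ∀ᵐ x ∂(𝔪.restrict U), |pairing F p dρ (φ j) x - gradNorm F dρ x ^ p| ≤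
      gradNorm F dρ x ^ (p - 1) *
        ((1 + C) * dualMetric F x (differential (φ j) x - dρ x)) := by
    intro j
    filter_upwards [ae_restrict_mem hU.measurableSet] with x hx
    have hN0 : 0 ≤ gradNorm F dρ x := hF.nonneg _
    have h1 : gradNorm F dρ x ^ p = gradNorm F dρ x ^ (p - 2) * dρ x (legendreInv F x (dρ x)) := by
      rw [hF.apply_legendreInv, ← rpow_sub_two_mul_sq hp hN0]; rfl
    have h2 : pairing F p dρ (φ j) x - gradNorm F dρ x ^ p = gradNorm F dρ x ^ (p - 2) *
        (differential (φ j) x - dρ x : Cotangent n x) (legendreInv F x (dρ x)) := by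
      rw [h1, pairing, ← mul_sub]; rfl
    rw [h2]
    refine abs_rpow_sub_two_mul_le hp hN0 ((hF.abs_apply_le x _ _).trans ?_)
    refine mul_le_mul_of_nonneg_right ?_ hN0
    have h3 := hF.dualMetric_nonneg x (differential (φ j) x - dρ x)
    have h4 := hF.dualMetric_neg_le hC (hrev x (subset_closure hx)) (differential (φ j) x - dρ x)
    exact max_le (by nlinarith) (by nlinarith)
  obtain ⟨ns, hns⟩ := exists_subseq_tendsto_integral (w := fun x => |u x| ^ p) hp hρm hρp
    (fun x => hF.nonneg _) hNm hNp hψ hψ' hL ham hA haA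
    (hu.1.continuous.abs.measurable.aemeasurable.pow_const p) hB
    (fun x => (abs_of_nonneg (Real.rpow_nonneg (abs_nonneg (u x)) p)).le.trans (huB x)) hφm hlim1
    (T := fun j x => pairing F p dρ (φ j) x)
    (fun j => (hNm.pow_const _).mul
      ((hdφ j).aemeasurable_apply_legendreInv hdρ hU.measurableSet hF)) hD0
    (fun j => (((hdφ j).sub hdρ).aemeasurable_dualMetric hU.measurableSet hF).const_mul _)
    hDp hTD
  refine ge_of_tendsto' (hns.const_mul c) fun j => ?_
  have htest := isTestFunction_abs_rpow_mul hp hu hU huU (hφ1 (ns j)) hψ hψ'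
  have hw := hweak _ htest fun x => mul_nonneg (Real.rpow_nonneg (abs_nonneg _) _) (hψpos _).le
  -- The approximation carries no information off `U`, but there the test function vanishes locally,
  -- so its differential is zero and the integral over `Ω` reduces to `U`.
  have hoff : ∀ x ∈ Ω \ U, F ⟨x, legendreInv F x (dρ x)⟩ ^ (p - 2) *
      differential (fun x => |u x| ^ p * ψ (φ (ns j) x)) x (legendreInv F x (dρ x)) = 0 := by
    intro x hx
    have h1 : x ∉ tsupport fun x => |u x| ^ p * ψ (φ (ns j) x) := fun h => by
      refine hx.2 (huU (closure_mono (fun y hy => ?_) h))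
      rw [Function.mem_support] at hy ⊢
      intro h
      apply hy
      simp [h, Real.zero_rpow (by linarith : p ≠ 0)]
    rw [differential_of_notMem_tsupport h1]
    simp
  rw [setIntegral_eq_of_subset_of_forall_sdiff_eq_zero hΩ.measurableSet hUΩ' hoff] at hw
  refine hw.trans_eq (congrArg (c * ·) (setIntegral_congr_fun hU.measurableSet fun x hx => ?_))
  have hd1 : MDifferentiableAt (𝓡 n) 𝓘(ℝ, ℝ) u x :=
    (hu.1 x).mdifferentiableAt (by simp)
  have hd2 : MDifferentiableAt (𝓡 n) 𝓘(ℝ, ℝ) (φ (ns j)) x :=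
    ((hφ1 (ns j)).contMDiffAt (hU.mem_nhds hx)).mdifferentiableAt (n := 1) one_ne_zero
  have h1 := differential_mul_comp_apply (hasDerivAt_abs_rpow (u x) hp) (hψ (φ (ns j) x))
    hd1 hd2 (legendreInv F x (dρ x))
  simp only [h1, pairing, gradNorm]
  ring

end

/-! ### The Hardy inequality on a neighbourhood of the support -/

section

variable {n : ℕ} {M : Type*} [TopologicalSpace M] [ChartedSpace (EuclideanSpace ℝ (Fin n)) M]
  [SecondCountableTopology M] [IsManifold (𝓡 n) ∞ M] [MeasurableSpace M]
  [BorelSpace M] {F : TangentBundle (𝓡 n) M → ℝ} {𝔪 : Measure M} {Ω U : Set M} {p α : ℝ}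
  {ρ u : M → ℝ} {dρ : (x : M) → Cotangent n x}

/-- For `0 < α ≤ p` the bound `ρ^α ≤ 1 + ρ^p` suffices. Only `α > p` calls for the extra
integrability. -/
theorem lintegral_rpow_ne_top {X : Type*} [MeasurableSpace X] {μ : Measure X} [IsFiniteMeasure μ]
    {ρ : X → ℝ} (hρ0 : ∀ᵐ x ∂μ, 0 ≤ ρ x)
    (hρp : Integrable (fun x => |ρ x| ^ p) μ)
    (hint : p < α → Integrable (fun x => ρ x ^ α) μ) (hα : 0 < α) :
    ∫⁻ x, ENNReal.ofReal (ρ x) ^ α ∂μ ≠ ⊤ := by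
  rcases lt_or_ge p α with h | h
  · have h1 : ∫⁻ x, ENNReal.ofReal (ρ x) ^ α ∂μ = ∫⁻ x, ENNReal.ofReal (ρ x ^ α) ∂μ :=
      lintegral_congr_ae (hρ0.mono fun x hx => ENNReal.ofReal_rpow_of_nonneg hx hα.le)
    rw [h1]
    exact (hint h).lintegral_lt_top.ne
  · have h1 : ∫⁻ x, ENNReal.ofReal (ρ x) ^ α ∂μ ≤ ∫⁻ x, ENNReal.ofReal (1 + |ρ x| ^ p) ∂μ := by
      refine lintegral_mono_ae (hρ0.mono fun x hx => ?_)
      rw [ENNReal.ofReal_rpow_of_nonneg hx hα.le, abs_of_nonneg hx]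
      refine ENNReal.ofReal_le_ofReal ?_
      have h2 := Real.rpow_nonneg hx p
      rcases le_total (ρ x) 1 with h3 | h3
      · linarith [Real.rpow_le_one hx h3 hα.le]
      · linarith [Real.rpow_le_rpow_of_exponent_le h3 h]
    exact ne_top_of_le_ne_top ((integrable_const 1).add hρp).lintegral_lt_top.ne h1

theorem hardy_setLIntegral (hF : IsFinslerMetric F) (hp : 1 < p) (hα : p - 1 - α ≠ 0)
    (h𝔪 : IsLocallyFiniteMeasure 𝔪) (hΩ : IsOpen Ω) (hρ : HasWeakDifferential F 𝔪 p Ω ρ dρ)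
    (hρ0 : ∀ᵐ x ∂(𝔪.restrict Ω), 0 ≤ ρ x)
    (hweak : WeakNegPLaplacianNonneg F 𝔪 p (p - 1 - α) Ω dρ)
    (hint : p < α → LocallyIntegrableOn (fun x => ρ x ^ α) Ω 𝔪)
    (hu : IsTestFunction n ∞ Ω u) (hU : IsOpen U)
    (hUc : IsCompact (closure U)) (hUΩ : closure U ⊆ Ω) (huU : tsupport u ⊆ U) :
    ENNReal.ofReal ((|p - 1 - α| / p) ^ p) *
        ∫⁻ x in U, ENNReal.ofReal (gradNorm F dρ x ^ p) /
          ENNReal.ofReal (ρ x) ^ (p - α) * ENNReal.ofReal (|u x| ^ p) ∂𝔪 ≤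
      ∫⁻ x in U, ENNReal.ofReal (ρ x) ^ α * ENNReal.ofReal
        (max (dualMetric F x (differential u x)) (dualMetric F x (-differential u x)) ^ p) ∂𝔪 := by
  have hp0 : 0 < p := by linarith
  have hUΩ' : U ⊆ Ω := subset_closure.trans hUΩ
  have : IsFiniteMeasure (𝔪.restrict U) := ⟨by
    rw [Measure.restrict_apply_univ]
    exact (measure_mono subset_closure).trans_lt hUc.measure_lt_top⟩
  obtain ⟨hρp, hNp⟩ := hρ.integrable hF hp hU hUc hUΩ
  have hmono : 𝔪.restrict U ≤ 𝔪.restrict Ω := Measure.restrict_mono hUΩ' le_rfl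
  have hρm : AEMeasurable ρ (𝔪.restrict U) := hρ.aemeasurable.mono_measure hmono
  have hρ0' : ∀ᵐ x ∂(𝔪.restrict U), 0 ≤ ρ x := ae_mono hmono hρ0
  have hdρ := hρ.measurable_differential.mono hUΩ'
  have hNm : AEMeasurable (gradNorm F dρ) (𝔪.restrict U) :=
    (hdρ.aemeasurable_dualMetric hU.measurableSet hF).congr
      (Eventually.of_forall fun x => hF.dualMetric_eq x (dρ x))
  have hN0 : ∀ x, 0 ≤ gradNorm F dρ x := fun x => hF.nonneg _
  have hu1 : ContMDiff (𝓡 n) 𝓘(ℝ, ℝ) 1 u :=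
    hu.1.of_le (WithTop.coe_le_coe.2 (le_top : (1 : ℕ∞) ≤ ⊤))
  have hdu := isMeasurableCovectorField_differential (𝔪 := 𝔪) hU hu1.contMDiffOn
  set m : M → ℝ := fun x =>
    max (dualMetric F x (differential u x)) (dualMetric F x (-differential u x)) with hm
  have hm0 : ∀ x, 0 ≤ m x := fun x => le_max_of_le_left (hF.dualMetric_nonneg _ _)
  have hmm : AEMeasurable m (𝔪.restrict U) :=
    (hdu.aemeasurable_dualMetric hU.measurableSet hF).max
      (hdu.neg.aemeasurable_dualMetric hU.measurableSet hF)
  obtain ⟨C, hC, hrev⟩ := hF.exists_reversibility_bound hUc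
  -- Continuity bounds `F*(du)` on the compact closure, and the reversibility constant transfers the
  -- bound to `F*(-du)`.
  obtain ⟨D, hD⟩ := hUc.exists_bound_of_continuousOn
    ((hF.continuousOn_dualMetric_differential isOpen_univ hu1.contMDiffOn).mono
      (subset_univ (closure U)))
  have hmD : ∀ᵐ x ∂(𝔪.restrict U), m x ≤ (1 + C) * |D| := by
    filter_upwards [ae_restrict_mem hU.measurableSet] with x hx
    have h1 : dualMetric F x (differential u x) ≤ |D| :=
      (le_abs_self _).trans ((hD x (subset_closure hx)).trans (le_abs_self D))
    have h2 := hF.dualMetric_neg_le hC (hrev x (subset_closure hx)) (differential u x)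
    have h3 := abs_nonneg D
    exact max_le (by nlinarith) (h2.trans (by nlinarith))
  obtain ⟨B, hB⟩ := hu.2.1.exists_bound_of_continuous hu.1.continuous
  have hB0 : 0 ≤ |B| := abs_nonneg B
  have huB : ∀ x, |u x| ≤ |B| := fun x => (hB x).trans (le_abs_self B)
  have hum : AEMeasurable u (𝔪.restrict U) := hu.1.continuous.measurable.aemeasurable
  have hpair : ∀ x, |pairing F p dρ u x| ≤ gradNorm F dρ x ^ (p - 1) * m x := fun x =>
    abs_rpow_sub_two_mul_le hp (hN0 x) (hF.abs_apply_le x _ _)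
  have hcoef : ∀ t : ℝ, |p * |t| ^ (p - 2) * t| = p * |t| ^ (p - 1) := fun t => by
    rcases eq_or_ne t 0 with rfl | ht
    · simp [Real.zero_rpow (by linarith : p - 1 ≠ 0)]
    · rw [abs_mul, abs_of_nonneg (mul_nonneg hp0.le (Real.rpow_nonneg (abs_nonneg t) _)),
        mul_assoc, ← Real.rpow_add_one (abs_pos.2 ht).ne']
      ring_nf
  have hale : ∀ x, |p * |u x| ^ (p - 2) * u x * pairing F p dρ u x| ≤
      p * (|u x| ^ (p - 1) * (gradNorm F dρ x ^ (p - 1) * m x)) := fun x => by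
    rw [abs_mul, hcoef, mul_assoc]
    have := hpair x
    gcongr
  have haA : ∀ᵐ x ∂(𝔪.restrict U), |p * |u x| ^ (p - 2) * u x * pairing F p dρ u x| ≤
      p * (|B| ^ (p - 1) * ((1 + C) * |D|)) * gradNorm F dρ x ^ (p - 1) := by
    filter_upwards [hmD] with x hx
    have h1 := Real.rpow_le_rpow (abs_nonneg _) (huB x) (by linarith : 0 ≤ p - 1)
    have h2 := Real.rpow_nonneg (hN0 x) (p - 1)
    have h3 := hm0 x
    calc _ ≤ p * (|u x| ^ (p - 1) * (gradNorm F dρ x ^ (p - 1) * m x)) := hale x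
      _ ≤ p * (|B| ^ (p - 1) * (gradNorm F dρ x ^ (p - 1) * ((1 + C) * |D|))) := by gcongr
      _ = _ := by ring
  have ham : AEMeasurable (fun x => p * |u x| ^ (p - 2) * u x * pairing F p dρ u x)
      (𝔪.restrict U) :=
    (((hum.norm.pow_const _).const_mul p).mul hum).mul
      ((hNm.pow_const _).mul (hdu.aemeasurable_apply_legendreInv hdρ hU.measurableSet hF))
  have huBp : ∀ x, |u x| ^ p ≤ |B| ^ p := fun x =>
    Real.rpow_le_rpow (abs_nonneg _) (huB x) hp0.le
  refine lintegral_le_of_truncated hp rfl hα hρm hρ0' hN0 hNm hum hmm hm0 hmD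
    (lintegral_rpow_ne_top hρ0' hρp fun h =>
      ((hint h).integrableOn_compact_subset hUΩ hUc).mono_set subset_closure) ?_
  intro ψ ψ' L hψ hψ' hL hψpos hψneg
  exact lintegral_le_of_weak hp hα hρm hρp hN0 hNm hNp hψ hψ' hL hψpos hψneg ham haA hum huBp
    hmm hm0 hale (hweak.exists_limit hF hp h𝔪 hΩ hρ hu hU hUc hUΩ huU hψ hψ' hL hψpos
      (by positivity) (by positivity) huBp ham haA)

end

end FinslerHardy

end

/-! ### The Hardy inequality on the whole domain -/

theorem theorem4p1 {n : ℕ} {M : Type*} [TopologicalSpace M] [T2Space M]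
    [SecondCountableTopology M] [ConnectedSpace M]
    [ChartedSpace (EuclideanSpace ℝ (Fin n)) M] [IsManifold (𝓡 n) ∞ M]
    [MeasurableSpace M] [BorelSpace M]
    (F : TangentBundle (𝓡 n) M → ℝ) (hF : FinslerHardy.IsFinslerMetric F)
    (hcomplete : FinslerHardy.IsForwardComplete F)
    (𝔪 : Measure M) (h𝔪 : FinslerHardy.IsSmoothMeasure n 𝔪)
    (Ω : Set M) (hΩ : FinslerHardy.IsNaturalDomain n Ω)
    (p α : ℝ) (hp : 1 < p)
    (ρ : M → ℝ) (dρ : (x : M) → FinslerHardy.Cotangent n x)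
    (hρ : FinslerHardy.HasWeakDifferential F 𝔪 p Ω ρ dρ)
    (hρ_nonneg : ∀ᵐ x ∂(𝔪.restrict Ω), 0 ≤ ρ x)
    (hweak : FinslerHardy.WeakNegPLaplacianNonneg F 𝔪 p (p - 1 - α) Ω dρ)
    (hint : p < α →
      LocallyIntegrableOn
        (fun x => F ⟨x, FinslerHardy.legendreInv F x (dρ x)⟩ ^ p / ρ x ^ (p - α)) Ω 𝔪 ∧
      LocallyIntegrableOn (fun x => ρ x ^ α) Ω 𝔪)
    (u : M → ℝ) (hu : FinslerHardy.IsTestFunction n ∞ Ω u) :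
    ENNReal.ofReal ((|p - 1 - α| / p) ^ p) *
        ∫⁻ x in Ω, ENNReal.ofReal (F ⟨x, FinslerHardy.legendreInv F x (dρ x)⟩ ^ p) /
          ENNReal.ofReal (ρ x) ^ (p - α) * ENNReal.ofReal (|u x| ^ p) ∂𝔪 ≤
      ∫⁻ x in Ω, ENNReal.ofReal (ρ x) ^ α *
        ENNReal.ofReal (max
          (FinslerHardy.dualMetric F x (FinslerHardy.differential u x) ^ p)
          (FinslerHardy.dualMetric F x (-FinslerHardy.differential u x) ^ p)) ∂𝔪 := by
  have hp0 : 0 < p := by linarith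
  -- For `α = p - 1` the constant vanishes and there is nothing to prove. Otherwise the exponent `b`
  -- is nonzero.
  rcases eq_or_ne (p - 1 - α) 0 with hα | hα
  · rw [hα, abs_zero, zero_div, Real.zero_rpow hp0.ne', ENNReal.ofReal_zero, zero_mul]
    exact zero_le
  have : LocallyCompactSpace M := ChartedSpace.locallyCompactSpace (EuclideanSpace ℝ (Fin n)) M
  -- Smooth approximations of `ρ` exist only on relatively compact open sets. Since `u` vanishes off
  -- `U`, restricting the left side to `U` loses nothing, and the right side only grows when `U` is
  -- enlarged to `Ω`.
  obtain ⟨U, hU, huU, hUΩ, hUc⟩ := exists_open_between_and_isCompact_closure hu.2.1 hΩ.1 hu.2.2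
  have hUΩ' : U ⊆ Ω := subset_closure.trans hUΩ
  have key := FinslerHardy.hardy_setLIntegral hF hp hα h𝔪.isLocallyFiniteMeasure hΩ.1 hρ hρ_nonneg
    hweak (fun h => (hint h).2) hu hU hUc hUΩ huU
  have hleft : ∫⁻ x in Ω, ENNReal.ofReal (F ⟨x, FinslerHardy.legendreInv F x (dρ x)⟩ ^ p) /
      ENNReal.ofReal (ρ x) ^ (p - α) * ENNReal.ofReal (|u x| ^ p) ∂𝔪 ≤
      ∫⁻ x in U, ENNReal.ofReal (FinslerHardy.gradNorm F dρ x ^ p) /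
        ENNReal.ofReal (ρ x) ^ (p - α) * ENNReal.ofReal (|u x| ^ p) ∂𝔪 := by
    rw [← lintegral_indicator hΩ.1.measurableSet, ← lintegral_indicator hU.measurableSet]
    refine lintegral_mono fun x => ?_
    by_cases hx : x ∈ U
    · rw [indicator_of_mem hx, indicator_of_mem (hUΩ' hx)]; exact le_rfl
    · have hux : u x = 0 := image_eq_zero_of_notMem_tsupport fun h => hx (huU h)
      refine le_of_eq_of_le ?_ zero_le
      refine indicator_apply_eq_zero.2 fun _ => ?_
      rw [hux, abs_zero, Real.zero_rpow hp0.ne', ENNReal.ofReal_zero, mul_zero]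
  have hmax : ∀ x, max (FinslerHardy.dualMetric F x (FinslerHardy.differential u x) ^ p)
      (FinslerHardy.dualMetric F x (-FinslerHardy.differential u x) ^ p) =
      max (FinslerHardy.dualMetric F x (FinslerHardy.differential u x))
        (FinslerHardy.dualMetric F x (-FinslerHardy.differential u x)) ^ p := fun x =>
    (Real.rpow_max (hF.dualMetric_nonneg _ _) (hF.dualMetric_nonneg _ _) hp0.le).symm
  simp_rw [hmax]
  exact (mul_le_mul_right hleft _).trans (key.trans (lintegral_mono_set hUΩ'))
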